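/- Let $R$ be a commutative ring with identity. An $R$-module $M$ is *Gorenstein flat* if there is an exact sequence $\cdots\to F_1\to F_0\to F^0\to F^1\to\cdots$ of flat $R$-modules with $M\cong\operatorname{im}(F_0\to F^0)$ that stays exact under $I\otimes_R-$ for every injective $R$-module $I$. Call $R$ *GF-closed* if the class of Gorenstein flat $R$-modules is closed under extensions. Let $C$ be a semidualizing $R$-module, that is, $C$ has a resolution by finitely generated projective modules, the homothety map $R\to\operatorname{Hom}_R(C,C)$ is an isomorphism, and $\operatorname{Ext}_R^{i}(C,C)=0$ for all $i\ge 1$. - $\mathcal{GF}_C(R)$ is the class of $G_C$-flat modules: those $M$ for which there is an exact sequence $\cdots\to F_1\to F_0\to C\otimes_R F^0\to C\otimes_R F^1\to\cdots$ with all $F_i,F^i$ flat and $M\cong\operatorname{im}(F_0\to C\otimes_R F^0)$ that stays exact under $\operatorname{Hom}_R(C,I)\otimes_R-$ for every injective $R$-module $I$. - $\mathcal B_C(R)$ is the Bass class: those $N$ such that $\operatorname{Ext}^{i}_R(C,N)=0=\operatorname{Tor}^R_{i}(C,\operatorname{Hom}_R(C,N))$ for all $i\ge1$ and the evaluation map $C\otimes_R\operatorname{Hom}_R(C,N)\to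 N$ is an isomorphism. For $\mathcal X=\mathcal{GF}_C(R)\cap\mathcal B_C(R)$ put $\mathcal G^1(\mathcal X)=\mathcal X$, and for $n\ge2$ let $\mathcal G^n(\mathcal X)$ be the class of all $R$-modules $M$ for which there is an exact sequence $\cdots\to G_1\to G_0\to G^0\to G^1\to\cdots$ of modules in $\mathcal G^{n-1}(\mathcal X)$ with $M\cong\operatorname{im}(G_0\to G^0)$ that stays exact under $\operatorname{Hom}_R(A,-)$ and under $A^+\otimes_R-$ for every $A\in\mathcal G^{n-1}(\mathcal X)$, where $A^+=\operatorname{Hom}_{\mathbb Z}(A,\mathbb Q/\mathbb Z)$. If $R$ is GF-closed, then $$\mathcal G^n\bigl(\mathcal{GF}_C(R)\cap\mathcal B_C(R)\bigr)=\mathcal{GF}_C(R)\cap\mathcal B_C(R)\qquad\text{for all } n\ge1.$$ -/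

import Mathlib

open CategoryTheory

universe u

namespace GorFlat

/-- A doubly infinite exact sequence of `R`-modules
`⋯ ⟶ X (-1) ⟶ X 0 ⟶ X 1 ⟶ X 2 ⟶ ⋯`, where `d i : X i ⟶ X (i + 1)`.
In the notation `⋯ ⟶ G₁ ⟶ G₀ ⟶ G⁰ ⟶ G¹ ⟶ ⋯` one has `Gᵢ = X (-i)` and `Gⁱ = X (1 + i)`. -/
structure ExactSeq (R : Type u) [CommRing R] where
  X : ℤ → ModuleCat.{u} R
  d : ∀ i : ℤ, X i →ₗ[R] X (i + 1)
  exact : ∀ i : ℤ, Function.Exact (d i) (d (i + 1))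

namespace ExactSeq

variable {R : Type u} [CommRing R]

/-- The sequence stays exact under `Hom_R(A, -)`. -/
def HomExact (S : ExactSeq R) (A : Type u) [AddCommGroup A] [Module R A] : Prop :=
  ∀ i : ℤ, Function.Exact (fun f : A →ₗ[R] S.X i => S.d i ∘ₗ f)
    (fun f : A →ₗ[R] S.X (i + 1) => S.d (i + 1) ∘ₗ f)

/-- The sequence stays exact under `A ⊗_R -`. -/
def TensorExact (S : ExactSeq R) (A : Type u) [AddCommGroup A] [Module R A] : Prop :=
  ∀ i : ℤ, Function.Exact ((S.d i).lTensor A) ((S.d (i + 1)).lTensor A)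

/-- `M ≅ im (G₀ ⟶ G⁰)`. -/
def HasImage (S : ExactSeq R) (M : Type u) [AddCommGroup M] [Module R M] : Prop :=
  Nonempty (M ≃ₗ[R] LinearMap.range (S.d 0))

end ExactSeq

/-- The class of Gorenstein flat `R`-modules. -/
def GorensteinFlat (R : Type u) [CommRing R] : ObjectProperty (ModuleCat.{u} R) := fun M =>
  ∃ S : ExactSeq R, (∀ i, Module.Flat R (S.X i)) ∧ S.HasImage M ∧
    ∀ (I : Type u) [AddCommGroup I] [Module R I], Module.Injective R I → S.TensorExact I

/-- `R` is GF-closed: the class of Gorenstein flat modules is closed under extensions. -/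
def IsGFClosed (R : Type u) [CommRing R] : Prop :=
  (GorensteinFlat R).IsClosedUnderExtensions

section Semidualizing

variable (R : Type u) [CommRing R] (C : Type u) [AddCommGroup C] [Module R C]

/-- `C` is a semidualizing `R`-module: it has a resolution by finitely generated projective
modules, the homothety map `R → Hom_R(C, C)` is an isomorphism, and `Ext^i_R(C, C) = 0` for
all `i ≥ 1`. -/
structure IsSemidualizing : Prop where
  exists_resolution : ∃ P : ProjectiveResolution (ModuleCat.of R C),
    ∀ n : ℕ, Module.Finite R (P.complex.X n)
  homothety_bijective : Function.Bijective (LinearMap.lsmul R C : R →ₗ[R] C →ₗ[R] C)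
  ext_eq_zero : ∀ n : ℕ, 1 ≤ n →
    Subsingleton (Abelian.Ext (ModuleCat.of R C) (ModuleCat.of R C) n)

/-- The class `F_C(R)` of `C`-flat modules: those isomorphic to `C ⊗ F` with `F` flat. -/
def CFlat : ObjectProperty (ModuleCat.{u} R) := fun M =>
  ∃ F : ModuleCat.{u} R, Module.Flat R F ∧ Nonempty (M ≃ₗ[R] TensorProduct R C F)

/-- The class `I_C(R)` of `C`-injective modules: those isomorphic to `Hom(C, I)` with `I`
injective. -/
def CInjective : ObjectProperty (ModuleCat.{u} R) := fun M =>
  ∃ I : ModuleCat.{u} R, Module.Injective R I ∧ Nonempty (M ≃ₗ[R] (C →ₗ[R] I))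

/-- The class `GF_C(R)` of `G_C`-flat modules. -/
def GCFlat : ObjectProperty (ModuleCat.{u} R) := fun M =>
  ∃ S : ExactSeq R, (∀ i : ℤ, i ≤ 0 → Module.Flat R (S.X i)) ∧
    (∀ i : ℤ, 1 ≤ i → CFlat R C (S.X i)) ∧ S.HasImage M ∧
    ∀ U : ModuleCat.{u} R, CInjective R C U → S.TensorExact U

/-- The natural evaluation map `C ⊗ Hom(C, N) → N`, `c ⊗ f ↦ f c`. -/
noncomputable def evalMap (N : Type u) [AddCommGroup N] [Module R N] :
    TensorProduct R C (C →ₗ[R] N) →ₗ[R] N :=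
  TensorProduct.lift LinearMap.applyₗ

/-- The Bass class `B_C(R)`. -/
def Bass : ObjectProperty (ModuleCat.{u} R) := fun N =>
  (∀ n : ℕ, 1 ≤ n → Subsingleton (Abelian.Ext (ModuleCat.of R C) N n)) ∧
  (∀ n : ℕ, 1 ≤ n → Limits.IsZero
    (((Tor (ModuleCat.{u} R) n).obj (ModuleCat.of R C)).obj (ModuleCat.of R (C →ₗ[R] N)))) ∧
  Function.Bijective (evalMap R C N)

end Semidualizing

/-- One step of the Gorenstein construction on a class `𝒳`: the modules isomorphic to
`im (G₀ ⟶ G⁰)` for an exact sequence `⋯ ⟶ G₁ ⟶ G₀ ⟶ G⁰ ⟶ G¹ ⟶ ⋯` in `𝒳` which stays exact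
under `Hom_R(A, -)` and under `A⁺ ⊗_R -` for all `A` in `𝒳`; here
`A⁺ = Hom_ℤ(A, ℚ/ℤ)` is the character module. -/
def gorStep {R : Type u} [CommRing R] (𝒳 : ObjectProperty (ModuleCat.{u} R)) :
    ObjectProperty (ModuleCat.{u} R) := fun M =>
  ∃ S : ExactSeq R, (∀ i, 𝒳 (S.X i)) ∧ S.HasImage M ∧
    (∀ A : ModuleCat.{u} R, 𝒳 A → S.HomExact A) ∧
    (∀ A : ModuleCat.{u} R, 𝒳 A → S.TensorExact (CharacterModule A))

/-- The classes `Gⁿ(𝒳)`, `n ≥ 1`: `G¹(𝒳) = 𝒳`, and `Gⁿ(𝒳)` is obtained from `Gⁿ⁻¹(𝒳)` by one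
step of the Gorenstein construction for `n ≥ 2`. (The value at `0` is not used.) -/
def gorIter {R : Type u} [CommRing R] (𝒳 : ObjectProperty (ModuleCat.{u} R)) :
    ℕ → ObjectProperty (ModuleCat.{u} R)
  | 0 => 𝒳
  | 1 => 𝒳
  | n + 2 => gorStep (gorIter 𝒳 (n + 1))

end GorFlat

/-!
By Foxby equivalence `Hom(C, -)` and `C ⊗ -` match `𝒢ℱ_C ∩ ℬ_C` with the modules that are
Gorenstein flat relative to the test class of injective modules together with `C`. If `R` is
GF-closed, this relative class is closed under extensions too: given `0 → X → Y → Z → 0` with `X`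
and `Z` in it, `Y` is Gorenstein flat, so it embeds into a flat module `F` with Gorenstein flat
cokernel `K`. For injective `J`, the horseshoe lemma combines the injective left resolutions of
`Hom(Z, J)` and `Hom(X, J)` into arbitrarily long ones of `Hom(Y, J)`, and Schanuel's lemma
transfers them to `Hom(K, J)`, so that `K` is acyclic against the larger test class as well.

Let `S` be the exact sequence exhibiting a module of `𝒢²`. Testing against `C ⊗ F` with `F` free
shows that `S` stays exact under `Hom(C, -)` and `U ⊗ -` for `C`-injective `U`, because every
injective module is a retract of the character module of a free module. Hence the images of `S` lie
in the Bass class, and applying `Hom(C, -)` coresolves their counterparts by relatively Gorenstein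
flat modules. Pushouts along such a coresolution stay in a class closed under extensions, which
replaces its terms by flat modules.
-/

namespace GorFlat

open TensorProduct

/-! ### Short exact sequences -/

section ShortExact

variable {R : Type*} [Ring R] {X Y Z : Type*} [AddCommGroup X] [Module R X]
  [AddCommGroup Y] [Module R Y] [AddCommGroup Z] [Module R Z]

/-- `0 ⟶ X ⟶ Y ⟶ Z ⟶ 0` is exact: `ShortComplex.ShortExact` for unbundled linear maps, so that the
three modules may be function modules, kernels or quotients without bundling them. -/
structure IsShortExact (f : X →ₗ[R] Y) (g : Y →ₗ[R] Z) : Prop where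
  injective : Function.Injective f
  exact : Function.Exact f g
  surjective : Function.Surjective g

namespace IsShortExact

variable {f : X →ₗ[R] Y} {g : Y →ₗ[R] Z}

theorem exists_comp_eq_right (h : IsShortExact f g) {A : Type*} [AddCommGroup A] [Module R A]
    (k : Y →ₗ[R] A) (hk : k ∘ₗ f = 0) : ∃ l : Z →ₗ[R] A, l ∘ₗ g = k := by
  have hker : LinearMap.ker g ≤ LinearMap.ker k := by
    rw [h.exact.linearMap_ker_eq]
    exact LinearMap.range_le_ker_iff.2 hk
  let e := g.quotKerEquivOfSurjective h.surjective
  refine ⟨(LinearMap.ker g).liftQ k hker ∘ₗ e.symm, LinearMap.ext fun y ↦ ?_⟩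
  have : e.symm (g y) = Submodule.Quotient.mk y := e.symm_apply_eq.2 rfl
  simp [this]

theorem exists_comp_eq_left (h : IsShortExact f g) {A : Type*} [AddCommGroup A] [Module R A]
    (k : A →ₗ[R] Y) (hk : g ∘ₗ k = 0) : ∃ l : A →ₗ[R] X, f ∘ₗ l = k := by
  have hr (a : A) : k a ∈ LinearMap.range f := (h.exact (k a)).1 (LinearMap.congr_fun hk a)
  let e := LinearEquiv.ofInjective f h.injective
  exact ⟨e.symm ∘ₗ k.codRestrict _ hr, LinearMap.ext fun a ↦
    congrArg Subtype.val (e.apply_symm_apply (k.codRestrict _ hr a))⟩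

theorem subtype_ker_self (hg : Function.Surjective g) :
    IsShortExact (LinearMap.ker g).subtype g :=
  ⟨Subtype.val_injective, g.exact_subtype_ker_map, hg⟩

theorem subtype_range (h : Function.Exact f g) (hg : Function.Surjective g) :
    IsShortExact (LinearMap.range f).subtype g := by
  rw [← h.linearMap_ker_eq]
  exact subtype_ker_self hg

theorem self_mkQ_range (hf : Function.Injective f) : IsShortExact f (LinearMap.range f).mkQ :=
  ⟨hf, f.exact_map_mkQ_range, Submodule.mkQ_surjective _⟩

theorem subtype_range_rangeRestrict (h : Function.Exact f g) :
    IsShortExact (LinearMap.range f).subtype g.rangeRestrict := by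
  rw [← h.linearMap_ker_eq, ← g.ker_rangeRestrict]
  exact subtype_ker_self g.surjective_rangeRestrict

theorem zero_equiv {O : Type*} [AddCommGroup O] [Module R O] [Subsingleton O] (e : Y ≃ₗ[R] Z) :
    IsShortExact (0 : O →ₗ[R] Y) (e : Y →ₗ[R] Z) :=
  ⟨Function.injective_of_subsingleton _, LinearMap.exact_zero_iff_injective O (e : Y →ₗ[R] Z)
    |>.2 e.injective, e.surjective⟩

theorem equiv_zero {O : Type*} [AddCommGroup O] [Module R O] [Subsingleton O] (e : X ≃ₗ[R] Y) :
    IsShortExact (e : X →ₗ[R] Y) (0 : Y →ₗ[R] O) :=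
  ⟨e.injective, LinearMap.exact_zero_iff_surjective O (e : X →ₗ[R] Y) |>.2 e.surjective,
    Function.surjective_to_subsingleton _⟩

theorem inl_snd : IsShortExact (LinearMap.inl R X Y) (LinearMap.snd R X Y) :=
  ⟨LinearMap.inl_injective, .inl_snd, LinearMap.snd_surjective⟩

theorem inr_fst : IsShortExact (LinearMap.inr R X Y) (LinearMap.fst R X Y) :=
  ⟨LinearMap.inr_injective, .inr_fst, LinearMap.fst_surjective⟩

theorem prod_id_sub (s : X →ₗ[R] Y) :
    IsShortExact (LinearMap.id.prod s) (LinearMap.snd R X Y - s ∘ₗ LinearMap.fst R X Y) where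
  injective _ _ h := congrArg Prod.fst h
  exact := by
    rintro ⟨x, y⟩
    simp [sub_eq_zero, eq_comm (a := s x)]
  surjective y := ⟨(0, y), by simp⟩

variable {X' Y' : Type*} [AddCommGroup X'] [Module R X'] [AddCommGroup Y'] [Module R Y']

theorem of_ladder_equiv {f' : X' →ₗ[R] Y'} {g' : Y' →ₗ[R] Z} (h : IsShortExact f g)
    (e₁ : X ≃ₗ[R] X') (e₂ : Y ≃ₗ[R] Y') (hf : f' ∘ₗ e₁ = e₂ ∘ₗ f) (hg : g' ∘ₗ e₂ = g) :
    IsShortExact f' g' where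
  injective := by
    have := e₂.injective.comp h.injective
    rw [← LinearEquiv.coe_coe, ← LinearMap.coe_comp, ← hf] at this
    exact (Function.Injective.of_comp_iff' _ e₁.bijective).1 this
  exact := .of_ladder_linearEquiv_of_exact (e₃ := .refl R Z) hf hg h.exact
  surjective := by
    rw [← hg] at h
    exact .of_comp h.surjective

end IsShortExact

end ShortExact

namespace IsShortExact

section NineLemma

variable {R : Type*} [Ring R] {A₁ A₂ A₃ B₁ B₂ B₃ C₁ C₂ C₃ : Type*}
  [AddCommGroup A₁] [Module R A₁] [AddCommGroup A₂] [Module R A₂] [AddCommGroup A₃] [Module R A₃]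
  [AddCommGroup B₁] [Module R B₁] [AddCommGroup B₂] [Module R B₂] [AddCommGroup B₃] [Module R B₃]
  [AddCommGroup C₁] [Module R C₁] [AddCommGroup C₂] [Module R C₂] [AddCommGroup C₃] [Module R C₃]
  {i₁ : A₁ →ₗ[R] B₁} {i₂ : A₂ →ₗ[R] B₂} {i₃ : A₃ →ₗ[R] B₃}
  {p₁ : B₁ →ₗ[R] C₁} {p₂ : B₂ →ₗ[R] C₂} {p₃ : B₃ →ₗ[R] C₃}

theorem exists_kernel_row {f : B₁ →ₗ[R] B₂} {g : B₂ →ₗ[R] B₃} {f' : C₁ →ₗ[R] C₂}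
    {g' : C₂ →ₗ[R] C₃} (hB : IsShortExact f g) (hC : IsShortExact f' g')
    (h₁ : IsShortExact i₁ p₁) (h₂ : IsShortExact i₂ p₂) (h₃ : IsShortExact i₃ p₃)
    (hf : p₂ ∘ₗ f = f' ∘ₗ p₁) (hg : p₃ ∘ₗ g = g' ∘ₗ p₂) :
    ∃ (a : A₁ →ₗ[R] A₂) (b : A₂ →ₗ[R] A₃), IsShortExact a b := by
  obtain ⟨a, ha⟩ := h₂.exists_comp_eq_left (f ∘ₗ i₁) (by
    rw [← LinearMap.comp_assoc, hf, LinearMap.comp_assoc, h₁.exact.linearMap_comp_eq_zero,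
      LinearMap.comp_zero])
  obtain ⟨b, hb⟩ := h₃.exists_comp_eq_left (g ∘ₗ i₂) (by
    rw [← LinearMap.comp_assoc, hg, LinearMap.comp_assoc, h₂.exact.linearMap_comp_eq_zero,
      LinearMap.comp_zero])
  simp only [LinearMap.ext_iff, LinearMap.comp_apply] at ha hb hf hg
  refine ⟨a, b, ?_, fun y ↦ ⟨fun hy ↦ ?_, ?_⟩, fun z ↦ ?_⟩
  · exact fun w w' hw ↦ h₁.injective (hB.injective (by rw [← ha, ← ha, hw]))
  · obtain ⟨x, hx⟩ := (hB.exact (i₂ y)).1 (by rw [← hb, hy, map_zero])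
    obtain ⟨w, rfl⟩ := (h₁.exact x).1 (hC.injective (by
      rw [← hf, hx, h₂.exact.apply_apply_eq_zero, map_zero]))
    exact ⟨w, h₂.injective ((ha w).trans hx)⟩
  · rintro ⟨w, rfl⟩
    exact h₃.injective (by rw [hb, ha, hB.exact.apply_apply_eq_zero, map_zero])
  · obtain ⟨y, hy⟩ := hB.surjective (i₃ z)
    obtain ⟨c, hc⟩ := (hC.exact (p₂ y)).1 (by rw [← hg, hy, h₃.exact.apply_apply_eq_zero])
    obtain ⟨x, rfl⟩ := h₁.surjective c
    obtain ⟨t, ht⟩ := (h₂.exact (y - f x)).1 (by rw [map_sub, hf, hc, sub_self])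
    exact ⟨t, h₃.injective (by
      rw [hb, ht, map_sub, hB.exact.apply_apply_eq_zero, sub_zero, hy])⟩

theorem exists_cokernel_row {f : A₁ →ₗ[R] A₂} {g : A₂ →ₗ[R] A₃} {f' : B₁ →ₗ[R] B₂}
    {g' : B₂ →ₗ[R] B₃} (hA : IsShortExact f g) (hB : IsShortExact f' g')
    (h₁ : IsShortExact i₁ p₁) (h₂ : IsShortExact i₂ p₂) (h₃ : IsShortExact i₃ p₃)
    (hf : i₂ ∘ₗ f = f' ∘ₗ i₁) (hg : i₃ ∘ₗ g = g' ∘ₗ i₂) :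
    ∃ (a : C₁ →ₗ[R] C₂) (b : C₂ →ₗ[R] C₃), IsShortExact a b := by
  obtain ⟨a, ha⟩ := h₁.exists_comp_eq_right (p₂ ∘ₗ f') (by
    rw [LinearMap.comp_assoc, ← hf, ← LinearMap.comp_assoc, h₂.exact.linearMap_comp_eq_zero,
      LinearMap.zero_comp])
  obtain ⟨b, hb⟩ := h₂.exists_comp_eq_right (p₃ ∘ₗ g') (by
    rw [LinearMap.comp_assoc, ← hg, ← LinearMap.comp_assoc, h₃.exact.linearMap_comp_eq_zero,
      LinearMap.zero_comp])
  simp only [LinearMap.ext_iff, LinearMap.comp_apply] at ha hb hf hg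
  refine ⟨a, b, (injective_iff_map_eq_zero a).2 fun c hc ↦ ?_,
    fun c ↦ ⟨fun hc ↦ ?_, ?_⟩, fun c ↦ ?_⟩
  · obtain ⟨x, rfl⟩ := h₁.surjective c
    obtain ⟨y, hy⟩ := (h₂.exact (f' x)).1 (by rw [← ha, hc])
    obtain ⟨w, rfl⟩ := (hA.exact y).1 (h₃.injective (by
      rw [hg, hy, hB.exact.apply_apply_eq_zero, map_zero]))
    rw [← hB.injective ((hf w).symm.trans hy), h₁.exact.apply_apply_eq_zero]
  · obtain ⟨y, rfl⟩ := h₂.surjective c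
    obtain ⟨z, hz⟩ := (h₃.exact (g' y)).1 (by rw [← hb, hc])
    obtain ⟨t, rfl⟩ := hA.surjective z
    obtain ⟨x, hx⟩ := (hB.exact (y - i₂ t)).1 (by rw [map_sub, ← hg, hz, sub_self])
    exact ⟨p₁ x, by rw [ha, hx, map_sub, h₂.exact.apply_apply_eq_zero, sub_zero]⟩
  · rintro ⟨c, rfl⟩
    obtain ⟨x, rfl⟩ := h₁.surjective c
    rw [ha, hb, hB.exact.apply_apply_eq_zero, map_zero]
  · obtain ⟨z, rfl⟩ := h₃.surjective c
    obtain ⟨y, rfl⟩ := hB.surjective z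
    exact ⟨p₂ y, hb y⟩

end NineLemma

section Diagrams

variable {R : Type*} [Ring R] {X Y Z W V : Type*} [AddCommGroup X] [Module R X]
  [AddCommGroup Y] [Module R Y] [AddCommGroup Z] [Module R Z] [AddCommGroup W] [Module R W]
  [AddCommGroup V] [Module R V]

theorem exists_ker_comp {f : X →ₗ[R] Y} {g : Y →ₗ[R] Z} {f' : W →ₗ[R] V} {g' : V →ₗ[R] Y}
    (h : IsShortExact f g) (h' : IsShortExact f' g') :
    ∃ (a : W →ₗ[R] LinearMap.ker (g ∘ₗ g')) (b : LinearMap.ker (g ∘ₗ g') →ₗ[R] X),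
      IsShortExact a b :=
  h'.exists_kernel_row (zero_equiv (O := PUnit.{1}) (.refl R Z)) (equiv_zero (.refl R W))
    (subtype_ker_self (h.surjective.comp h'.surjective)) h
    (by rw [LinearMap.comp_assoc, h'.exact.linearMap_comp_eq_zero]; simp) rfl

theorem exists_coker_comp {f : X →ₗ[R] Y} {g : Y →ₗ[R] Z} {f' : Y →ₗ[R] W} {g' : W →ₗ[R] V}
    (h : IsShortExact f g) (h' : IsShortExact f' g') :
    ∃ (a : Z →ₗ[R] W ⧸ LinearMap.range (f' ∘ₗ f)) (b : W ⧸ LinearMap.range (f' ∘ₗ f) →ₗ[R] V),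
      IsShortExact a b :=
  (equiv_zero (O := PUnit.{1}) (.refl R X)).exists_cokernel_row h' h
    (self_mkQ_range (h'.injective.comp h.injective)) (zero_equiv (.refl R V)) rfl
    (by rw [← LinearMap.comp_assoc, h'.exact.linearMap_comp_eq_zero]; simp)

theorem exists_pushout {j : X →ₗ[R] Y} {q : Y →ₗ[R] Z} {i : X →ₗ[R] W} {p : W →ₗ[R] V}
    (h : IsShortExact j q) (h' : IsShortExact i p) :
    ∃ (a : W →ₗ[R] (Y × W) ⧸ LinearMap.range (j.prod (-i)))
      (b : (Y × W) ⧸ LinearMap.range (j.prod (-i)) →ₗ[R] Z)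
      (c : Y →ₗ[R] (Y × W) ⧸ LinearMap.range (j.prod (-i)))
      (d : (Y × W) ⧸ LinearMap.range (j.prod (-i)) →ₗ[R] V),
      IsShortExact a b ∧ IsShortExact c d := by
  have hk : IsShortExact (j.prod (-i)) (LinearMap.range (j.prod (-i))).mkQ :=
    self_mkQ_range fun _ _ hx ↦ h.injective (congrArg Prod.fst hx)
  obtain ⟨a, b, hab⟩ := (zero_equiv (O := PUnit.{1}) (.refl R X)).exists_cokernel_row
    (inr_fst (X := Y) (Y := W)) (zero_equiv (.refl R W)) hk h (by simp) rfl
  obtain ⟨c, d, hcd⟩ := (zero_equiv (O := PUnit.{1}) (.neg R)).exists_cokernel_row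
    (inl_snd (X := Y) (Y := W)) (zero_equiv (.refl R Y)) hk h' (by simp)
    (LinearMap.ext fun x ↦ map_neg i x)
  exact ⟨a, b, c, d, hab, hcd⟩

variable {K₁ E₁ K₂ E₂ : Type*} [AddCommGroup K₁] [Module R K₁] [AddCommGroup E₁] [Module R E₁]
  [AddCommGroup K₂] [Module R K₂] [AddCommGroup E₂] [Module R E₂]

theorem exists_horseshoe {a : X →ₗ[R] Y} {b : Y →ₗ[R] Z} (h : IsShortExact a b)
    {i₁ : K₁ →ₗ[R] E₁} {p₁ : E₁ →ₗ[R] X} (h₁ : IsShortExact i₁ p₁)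
    {i₂ : K₂ →ₗ[R] E₂} {p₂ : E₂ →ₗ[R] Z} (h₂ : IsShortExact i₂ p₂)
    (q : E₂ →ₗ[R] Y) (hq : b ∘ₗ q = p₂) :
    Function.Surjective ((a ∘ₗ p₁).coprod q) ∧
      ∃ (c : K₁ →ₗ[R] LinearMap.ker ((a ∘ₗ p₁).coprod q))
        (d : LinearMap.ker ((a ∘ₗ p₁).coprod q) →ₗ[R] K₂), IsShortExact c d := by
  have hsurj : Function.Surjective ((a ∘ₗ p₁).coprod q) := by
    intro y
    obtain ⟨e₂, he₂⟩ := h₂.surjective (b y)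
    obtain ⟨x, hx⟩ := (h.exact (y - q e₂)).1 (by
      rw [map_sub, ← LinearMap.comp_apply, hq, he₂, sub_self])
    obtain ⟨e₁, rfl⟩ := h₁.surjective x
    exact ⟨(e₁, e₂), by simp [hx]⟩
  refine ⟨hsurj, (inl_snd (X := E₁) (Y := E₂)).exists_kernel_row h h₁ (subtype_ker_self hsurj) h₂
    (LinearMap.coprod_inl _ _) ?_⟩
  rw [LinearMap.comp_coprod, ← LinearMap.comp_assoc, h.exact.linearMap_comp_eq_zero, hq]
  ext <;> simp

theorem exists_schanuel {i₁ : K₁ →ₗ[R] E₁} {p₁ : E₁ →ₗ[R] Y} (h₁ : IsShortExact i₁ p₁)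
    {i₂ : K₂ →ₗ[R] E₂} {p₂ : E₂ →ₗ[R] Y} (h₂ : IsShortExact i₂ p₂) (s : E₁ →ₗ[R] E₂)
    (hs : p₂ ∘ₗ s = p₁) :
    ∃ (a : K₁ →ₗ[R] LinearMap.ker (p₁.coprod (-p₂)))
      (b : LinearMap.ker (p₁.coprod (-p₂)) →ₗ[R] E₂)
      (c : E₁ →ₗ[R] LinearMap.ker (p₁.coprod (-p₂)))
      (d : LinearMap.ker (p₁.coprod (-p₂)) →ₗ[R] K₂), IsShortExact a b ∧ IsShortExact c d := by
  have hK : IsShortExact (LinearMap.ker (p₁.coprod (-p₂))).subtype (p₁.coprod (-p₂)) :=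
    subtype_ker_self fun y ↦ (h₁.surjective y).imp' (·, 0) fun x hx ↦ by simp [hx]
  have hs' (x : E₁) : p₂ (s x) = p₁ x := LinearMap.congr_fun hs x
  obtain ⟨a, b, hab⟩ := (inl_snd (X := E₁) (Y := E₂)).exists_kernel_row
    (equiv_zero (O := PUnit.{1}) (.refl R Y)) h₁ hK (equiv_zero (.refl R E₂)) (by ext; simp)
    (Subsingleton.elim _ _)
  obtain ⟨c, d, hcd⟩ := (prod_id_sub s).exists_kernel_row
    (zero_equiv (O := PUnit.{1}) (.neg R)) (equiv_zero (.refl R E₁)) hK h₂ (by ext; simp [hs'])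
    (LinearMap.ext fun x ↦ by simp [hs', sub_eq_add_neg])
  exact ⟨a, b, c, d, hab, hcd⟩

end Diagrams

end IsShortExact

/-! ### Ext- and Tor-acyclic modules -/

section HomTensor

variable {R X Y Z A : Type*} [CommRing R] [AddCommGroup X] [Module R X] [AddCommGroup Y]
  [Module R Y] [AddCommGroup Z] [Module R Z] [AddCommGroup A] [Module R A]
  {f : X →ₗ[R] Y} {g : Y →ₗ[R] Z}

theorem IsShortExact.hom (h : IsShortExact f g)
    (hg : Function.Surjective fun l : A →ₗ[R] Y ↦ g ∘ₗ l) :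
    IsShortExact (f.compRight R : (A →ₗ[R] X) →ₗ[R] A →ₗ[R] Y) (g.compRight R) where
  injective _ _ hkl := LinearMap.ext fun a ↦ h.injective (LinearMap.congr_fun hkl a)
  exact k := ⟨h.exists_comp_eq_left k, by
    rintro ⟨l, rfl⟩; exact LinearMap.ext fun a ↦ h.exact.apply_apply_eq_zero _⟩
  surjective := hg

theorem IsShortExact.lTensor (h : IsShortExact f g) (hf : Function.Injective (f.lTensor A)) :
    IsShortExact (f.lTensor A) (g.lTensor A) where
  injective := hf
  exact := lTensor_exact A h.exact h.surjective
  surjective := LinearMap.lTensor_surjective A h.surjective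

end HomTensor

theorem IsShortExact.dual {R : Type*} [CommRing R] {X Y Z : Type u} [AddCommGroup X] [Module R X]
    [AddCommGroup Y] [Module R Y] [AddCommGroup Z] [Module R Z] {f : X →ₗ[R] Y} {g : Y →ₗ[R] Z}
    (h : IsShortExact f g) (J : Type u) [AddCommGroup J] [Module R J]
    [hJ : Module.Injective R J] : IsShortExact (g.lcomp R J) (f.lcomp R J) where
  injective := LinearMap.lcomp_injective_of_surjective g h.surjective
  exact := LinearMap.exact_lcomp_of_exact_of_surjective J h.exact h.surjective
  surjective k := (hJ.out f h.injective k).imp fun _ ↦ LinearMap.ext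

section ExtAcyclic

variable {R : Type u} [Ring R] (A B : Type u) [AddCommGroup A] [Module R A]
  [AddCommGroup B] [Module R B]

theorem injective_of_subsingleton [Subsingleton B] : Module.Injective R B :=
  ⟨fun _ _ _ _ _ _ _ _ _ ↦ ⟨0, fun _ ↦ Subsingleton.elim _ _⟩⟩

variable (R) in
/-- `Ext^n(A, B) = 0` for all `n ≥ 1`. -/
def ExtAcyclic : Prop :=
  ∀ n : ℕ, 1 ≤ n → Subsingleton (Abelian.Ext (ModuleCat.of R A) (ModuleCat.of R B) n)

theorem ExtAcyclic.of_injective [Module.Injective R B] : ExtAcyclic R A B := by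
  intro n hn
  obtain ⟨n, rfl⟩ := Nat.exists_eq_add_of_le' hn
  have := Module.injective_object_of_injective_module R B
  exact Abelian.Ext.subsingleton_of_injective _ _ n

theorem ExtAcyclic.of_projective [Module.Projective R A] : ExtAcyclic R A B := by
  intro n hn
  obtain ⟨n, rfl⟩ := Nat.exists_eq_add_of_le' hn
  have := (IsProjective.iff_projective (R := R) A).1 inferInstance
  exact Abelian.Ext.subsingleton_of_projective _ _ n

variable {A B} {X Y Z : Type u} [AddCommGroup X] [Module R X]
  [AddCommGroup Y] [Module R Y] [AddCommGroup Z] [Module R Z]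
  {f : X →ₗ[R] Y} {g : Y →ₗ[R] Z}

namespace IsShortExact

theorem shortExact (h : IsShortExact f g) :
    (ShortComplex.mk (ModuleCat.ofHom f) (ModuleCat.ofHom g)
      (ModuleCat.hom_ext h.exact.linearMap_comp_eq_zero)).ShortExact where
  exact := (ShortComplex.ShortExact.moduleCat_exact_iff_function_exact _).2 h.exact
  mono_f := (ModuleCat.mono_iff_injective _).2 h.injective
  epi_g := (ModuleCat.epi_iff_surjective _).2 h.surjective

theorem subsingleton_ext_mid (h : IsShortExact f g) {n : ℕ}
    (hX : Subsingleton (Abelian.Ext (ModuleCat.of R A) (ModuleCat.of R X) n))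
    (hZ : Subsingleton (Abelian.Ext (ModuleCat.of R A) (ModuleCat.of R Z) n)) :
    Subsingleton (Abelian.Ext (ModuleCat.of R A) (ModuleCat.of R Y) n) := by
  refine subsingleton_of_forall_eq 0 fun x ↦ ?_
  obtain ⟨y, rfl⟩ := Abelian.Ext.covariant_sequence_exact₂ _ h.shortExact x (hZ.elim _ _)
  rw [hX.elim y 0, Abelian.Ext.zero_comp]

theorem subsingleton_ext_right (h : IsShortExact f g) {n : ℕ}
    (hY : Subsingleton (Abelian.Ext (ModuleCat.of R A) (ModuleCat.of R Y) n))
    (hX : Subsingleton (Abelian.Ext (ModuleCat.of R A) (ModuleCat.of R X) (n + 1))) :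
    Subsingleton (Abelian.Ext (ModuleCat.of R A) (ModuleCat.of R Z) n) := by
  refine subsingleton_of_forall_eq 0 fun x ↦ ?_
  obtain ⟨y, rfl⟩ := Abelian.Ext.covariant_sequence_exact₃ _ h.shortExact x rfl (hX.elim _ _)
  rw [hY.elim y 0, Abelian.Ext.zero_comp]

theorem subsingleton_ext_left (h : IsShortExact f g) {n : ℕ}
    (hZ : Subsingleton (Abelian.Ext (ModuleCat.of R A) (ModuleCat.of R Z) n))
    (hY : Subsingleton (Abelian.Ext (ModuleCat.of R A) (ModuleCat.of R Y) (n + 1))) :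
    Subsingleton (Abelian.Ext (ModuleCat.of R A) (ModuleCat.of R X) (n + 1)) := by
  refine subsingleton_of_forall_eq 0 fun x ↦ ?_
  obtain ⟨y, rfl⟩ := Abelian.Ext.covariant_sequence_exact₁ _ h.shortExact x (hY.elim _ _) rfl
  rw [hZ.elim y 0, Abelian.Ext.zero_comp]

theorem subsingleton_ext_one_left (h : IsShortExact f g)
    (hg : Function.Surjective fun l : A →ₗ[R] Y ↦ g ∘ₗ l)
    (hY : Subsingleton (Abelian.Ext (ModuleCat.of R A) (ModuleCat.of R Y) 1)) :
    Subsingleton (Abelian.Ext (ModuleCat.of R A) (ModuleCat.of R X) 1) := by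
  refine subsingleton_of_forall_eq 0 fun x ↦ ?_
  obtain ⟨y, rfl⟩ := Abelian.Ext.covariant_sequence_exact₁ _ h.shortExact x (hY.elim _ _)
    (zero_add 1)
  obtain ⟨k, rfl⟩ := (Abelian.Ext.mk₀_bijective _ _).2 y
  obtain ⟨l, hl⟩ := hg k.hom
  have hk : k = ModuleCat.ofHom l ≫ ModuleCat.ofHom g := ModuleCat.hom_ext hl.symm
  have hδ := h.shortExact.comp_extClass
  dsimp only at hδ
  rw [hk, ← Abelian.Ext.mk₀_comp_mk₀, Abelian.Ext.comp_assoc_of_second_deg_zero, hδ,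
    Abelian.Ext.comp_zero]

theorem subsingleton_ext_one_quotient (h : IsShortExact f g)
    (hf : Function.Surjective fun l : Y →ₗ[R] B ↦ l ∘ₗ f)
    (hY : Subsingleton (Abelian.Ext (ModuleCat.of R Y) (ModuleCat.of R B) 1)) :
    Subsingleton (Abelian.Ext (ModuleCat.of R Z) (ModuleCat.of R B) 1) := by
  refine subsingleton_of_forall_eq 0 fun x ↦ ?_
  obtain ⟨y, rfl⟩ := Abelian.Ext.contravariant_sequence_exact₃ h.shortExact _ x (hY.elim _ _)
    (add_zero 1)
  obtain ⟨k, rfl⟩ := (Abelian.Ext.mk₀_bijective _ _).2 y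
  obtain ⟨l, hl⟩ := hf k.hom
  have hk : k = ModuleCat.ofHom f ≫ ModuleCat.ofHom l := ModuleCat.hom_ext hl.symm
  have hδ := h.shortExact.extClass_comp
  dsimp only at hδ
  rw [hk, ← Abelian.Ext.mk₀_comp_mk₀, ← Abelian.Ext.comp_assoc_of_second_deg_zero, hδ,
    Abelian.Ext.zero_comp]

theorem subsingleton_ext_succ_quotient (h : IsShortExact f g) {n : ℕ}
    (hX : Subsingleton (Abelian.Ext (ModuleCat.of R X) (ModuleCat.of R B) n))
    (hY : Subsingleton (Abelian.Ext (ModuleCat.of R Y) (ModuleCat.of R B) (n + 1))) :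
    Subsingleton (Abelian.Ext (ModuleCat.of R Z) (ModuleCat.of R B) (n + 1)) := by
  refine subsingleton_of_forall_eq 0 fun x ↦ ?_
  obtain ⟨y, rfl⟩ := Abelian.Ext.contravariant_sequence_exact₃ h.shortExact _ x (hY.elim _ _)
    (add_comm 1 n)
  rw [hX.elim y 0, Abelian.Ext.comp_zero]

theorem comp_right_surjective (h : IsShortExact f g) (hX : ExtAcyclic R A X) :
    Function.Surjective fun l : A →ₗ[R] Y ↦ g ∘ₗ l := by
  intro k
  obtain ⟨y, hy⟩ := Abelian.Ext.covariant_sequence_exact₃ _ h.shortExact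
    (Abelian.Ext.mk₀ (ModuleCat.ofHom k)) (zero_add 1) ((hX 1 le_rfl).elim _ _)
  obtain ⟨l, rfl⟩ := (Abelian.Ext.mk₀_bijective _ _).2 y
  rw [Abelian.Ext.mk₀_comp_mk₀] at hy
  exact ⟨l.hom, congrArg ModuleCat.Hom.hom ((Abelian.Ext.mk₀_bijective _ _).1 hy)⟩

theorem comp_left_surjective (h : IsShortExact f g) (hZ : ExtAcyclic R Z B) :
    Function.Surjective fun l : Y →ₗ[R] B ↦ l ∘ₗ f := by
  intro k
  obtain ⟨y, hy⟩ := Abelian.Ext.contravariant_sequence_exact₁ h.shortExact _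
    (Abelian.Ext.mk₀ (ModuleCat.ofHom k)) (add_zero 1) ((hZ 1 le_rfl).elim _ _)
  obtain ⟨l, rfl⟩ := (Abelian.Ext.mk₀_bijective _ _).2 y
  rw [Abelian.Ext.mk₀_comp_mk₀] at hy
  exact ⟨l.hom, congrArg ModuleCat.Hom.hom ((Abelian.Ext.mk₀_bijective _ _).1 hy)⟩

theorem extAcyclic_mid (h : IsShortExact f g) (hX : ExtAcyclic R A X) (hZ : ExtAcyclic R A Z) :
    ExtAcyclic R A Y :=
  fun n hn ↦ h.subsingleton_ext_mid (hX n hn) (hZ n hn)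

theorem extAcyclic_right (h : IsShortExact f g) (hX : ExtAcyclic R A X)
    (hY : ExtAcyclic R A Y) : ExtAcyclic R A Z :=
  fun n hn ↦ h.subsingleton_ext_right (hY n hn) (hX (n + 1) (by lia))

theorem extAcyclic_sub (h : IsShortExact f g) (hY : ExtAcyclic R Y B) (hZ : ExtAcyclic R Z B) :
    ExtAcyclic R X B := by
  refine fun n hn ↦ subsingleton_of_forall_eq 0 fun x ↦ ?_
  obtain ⟨y, rfl⟩ := Abelian.Ext.contravariant_sequence_exact₁ h.shortExact _ x rfl
    ((hZ (1 + n) (by lia)).elim _ _)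
  rw [(hY n hn).elim y 0, Abelian.Ext.comp_zero]

end IsShortExact

theorem ExtAcyclic.congr_right (h : ExtAcyclic R A X) (e : X ≃ₗ[R] Y) : ExtAcyclic R A Y := by
  have := injective_of_subsingleton (R := R) PUnit.{u + 1}
  exact (IsShortExact.zero_equiv (O := PUnit.{u + 1}) e).extAcyclic_right (.of_injective _ _) h

theorem ExtAcyclic.congr_left (h : ExtAcyclic R X B) (e : X ≃ₗ[R] Y) : ExtAcyclic R Y B :=
  (IsShortExact.equiv_zero (O := PUnit.{u + 1}) e.symm).extAcyclic_sub h (.of_projective _ _)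

theorem ExtAcyclic.of_coresolving (P : ObjectProperty (ModuleCat.{u} R))
    (h : ∀ Z, P Z → ∃ (S Z' : ModuleCat.{u} R) (f : Z →ₗ[R] S) (g : S →ₗ[R] Z'),
      IsShortExact f g ∧ ExtAcyclic R A S ∧
        (Function.Surjective fun l : A →ₗ[R] S ↦ g ∘ₗ l) ∧ P Z')
    {Z : ModuleCat.{u} R} (hZ : P Z) : ExtAcyclic R A Z := by
  intro n hn
  induction n, hn using Nat.le_induction generalizing Z with
  | base =>
    obtain ⟨S, Z', f, g, hs, hS, hg, -⟩ := h Z hZ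
    exact hs.subsingleton_ext_one_left hg (hS 1 le_rfl)
  | succ n _ ih =>
    obtain ⟨S, Z', f, g, hs, hS, -, hZ'⟩ := h Z hZ
    exact hs.subsingleton_ext_left (ih hZ') (hS _ (by lia))

theorem ExtAcyclic.of_resolving (P : ObjectProperty (ModuleCat.{u} R))
    (h : ∀ Z, P Z → ∃ (S Z' : ModuleCat.{u} R) (f : Z' →ₗ[R] S) (g : S →ₗ[R] Z),
      IsShortExact f g ∧ ExtAcyclic R S B ∧
        (Function.Surjective fun l : S →ₗ[R] B ↦ l ∘ₗ f) ∧ P Z')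
    {Z : ModuleCat.{u} R} (hZ : P Z) : ExtAcyclic R Z B := by
  intro n hn
  induction n, hn using Nat.le_induction generalizing Z with
  | base =>
    obtain ⟨S, Z', f, g, hs, hS, hf, -⟩ := h Z hZ
    exact hs.subsingleton_ext_one_quotient hf (hS 1 le_rfl)
  | succ n _ ih =>
    obtain ⟨S, Z', f, g, hs, hS, -, hZ'⟩ := h Z hZ
    exact hs.subsingleton_ext_succ_quotient (ih hZ') (hS _ (by lia))

end ExtAcyclic

section TorAcyclic

variable {R : Type u} [CommRing R]

theorem exists_injective_embedding (M : Type u) [AddCommGroup M] [Module R M] :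
    ∃ (J : ModuleCat.{u} R) (f : M →ₗ[R] J), Module.Injective R J ∧ Function.Injective f := by
  obtain ⟨J⟩ := EnoughInjectives.presentation (ModuleCat.of R M)
  exact ⟨J.J, J.f.hom, (Module.injective_iff_injective_object R J.J).2 J.injective,
    (ModuleCat.mono_iff_injective _).1 J.mono⟩

theorem exists_free_presentation (M : Type u) [AddCommGroup M] [Module R M] :
    ∃ (K P : ModuleCat.{u} R) (f : K →ₗ[R] P) (g : P →ₗ[R] M), IsShortExact f g ∧
      Module.Free R P := by
  let g := Finsupp.linearCombination R (id : M → M)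
  exact ⟨.of R (LinearMap.ker g), .of R (M →₀ R), _, g,
    .subtype_ker_self (Finsupp.linearCombination_id_surjective R M),
    inferInstanceAs (Module.Free R (M →₀ R))⟩

theorem injective_of_forall_lcomp_surjective {X Y : Type u} [AddCommGroup X] [Module R X]
    [AddCommGroup Y] [Module R Y] (f : X →ₗ[R] Y)
    (h : ∀ (J : Type u) [AddCommGroup J] [Module R J] [Module.Injective R J],
      Function.Surjective (f.lcomp R J)) : Function.Injective f := by
  obtain ⟨J, k, hJ, hk⟩ := exists_injective_embedding (R := R) X
  obtain ⟨l, rfl⟩ := h J k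
  exact .of_comp hk

instance injective_hom_of_flat (F J : Type u) [AddCommGroup F] [Module R F] [AddCommGroup J]
    [Module R J] [Module.Flat R F] [hJ : Module.Injective R J] :
    Module.Injective R (F →ₗ[R] J) where
  out X Y _ _ _ _ f hf g := by
    obtain ⟨h, hh⟩ := hJ.out (f.rTensor F)
      (Module.Flat.rTensor_preserves_injective_linearMap f hf) (TensorProduct.lift g)
    refine ⟨TensorProduct.curry h, fun x ↦ LinearMap.ext fun y ↦ ?_⟩
    simpa using hh (x ⊗ₜ y)

variable (A B : Type u) [AddCommGroup A] [Module R A] [AddCommGroup B] [Module R B]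

variable (R) in
/-- `Tor_n(A, B) = 0` for all `n ≥ 1`, expressed through the duality
`Ext^n(A, Hom(B, J)) ≅ Hom(Tor_n(A, B), J)` for injective `J`. -/
def TorAcyclic : Prop :=
  ∀ (J : Type u) [AddCommGroup J] [Module R J] [Module.Injective R J],
    ExtAcyclic R A (B →ₗ[R] J)

theorem TorAcyclic.of_flat [Module.Flat R B] : TorAcyclic R A B :=
  fun _ _ _ _ ↦ .of_injective _ _

variable {A B} {X Y Z : Type u} [AddCommGroup X] [Module R X]
  [AddCommGroup Y] [Module R Y] [AddCommGroup Z] [Module R Z]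
  {f : X →ₗ[R] Y} {g : Y →ₗ[R] Z}

theorem lcomp_comp_surjective_iff {J : Type u} [AddCommGroup J] [Module R J] :
    (Function.Surjective fun l : A →ₗ[R] Y →ₗ[R] J ↦ f.lcomp R J ∘ₗ l) ↔
      Function.Surjective ((f.lTensor A).lcomp R J) := by
  constructor
  · intro h k
    obtain ⟨l, hl⟩ := h (TensorProduct.curry k)
    refine ⟨TensorProduct.lift l, TensorProduct.ext' fun a x ↦ ?_⟩
    simpa using LinearMap.congr_fun (LinearMap.congr_fun hl a) x
  · intro h k
    obtain ⟨l, hl⟩ := h (TensorProduct.lift k)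
    refine ⟨TensorProduct.curry l, LinearMap.ext fun a ↦ LinearMap.ext fun x ↦ ?_⟩
    simpa using LinearMap.congr_fun hl (a ⊗ₜ x)

theorem lcomp_comp_surjective (hf : Function.Injective (f.lTensor A)) {J : Type u}
    [AddCommGroup J] [Module R J] [hJ : Module.Injective R J] :
    Function.Surjective fun l : A →ₗ[R] Y →ₗ[R] J ↦ f.lcomp R J ∘ₗ l :=
  lcomp_comp_surjective_iff.2 fun k ↦ (hJ.out _ hf k).imp fun _ ↦ LinearMap.ext

theorem TorAcyclic.congr_right (h : TorAcyclic R A X) (e : X ≃ₗ[R] Y) : TorAcyclic R A Y :=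
  fun J _ _ _ ↦ (h J).congr_right (e.congrLeft J R)

theorem TorAcyclic.congr_left (h : TorAcyclic R X B) (e : X ≃ₗ[R] Y) : TorAcyclic R Y B :=
  fun J _ _ _ ↦ (h J).congr_left e

namespace IsShortExact

theorem lTensor_injective (h : IsShortExact f g) (hZ : TorAcyclic R A Z) :
    Function.Injective (f.lTensor A) :=
  injective_of_forall_lcomp_surjective _ fun J _ _ _ ↦
    lcomp_comp_surjective_iff.1 ((h.dual J).comp_right_surjective (hZ J))

theorem torAcyclic_left (h : IsShortExact f g) (hY : TorAcyclic R A Y) (hZ : TorAcyclic R A Z) :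
    TorAcyclic R A X :=
  fun J _ _ _ ↦ (h.dual J).extAcyclic_right (hZ J) (hY J)

theorem torAcyclic_right (h : IsShortExact f g) (hX : TorAcyclic R A X) (hY : TorAcyclic R A Y)
    (hf : Function.Injective (f.lTensor A)) : TorAcyclic R A Z := by
  intro J _ _ _ n hn
  obtain ⟨n, rfl⟩ := Nat.exists_eq_add_of_le' hn
  cases n with
  | zero => exact (h.dual J).subsingleton_ext_one_left (lcomp_comp_surjective hf) (hY J 1 le_rfl)
  | succ n => exact (h.dual J).subsingleton_ext_left (hX J _ (by lia)) (hY J _ (by lia))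

end IsShortExact

theorem TorAcyclic.of_resolving (P : ObjectProperty (ModuleCat.{u} R))
    (h : ∀ Z, P Z → ∃ (S Z' : ModuleCat.{u} R) (f : Z' →ₗ[R] S) (g : S →ₗ[R] Z),
      IsShortExact f g ∧ TorAcyclic R A S ∧ Function.Injective (f.lTensor A) ∧ P Z')
    {Z : ModuleCat.{u} R} (hZ : P Z) : TorAcyclic R A Z := by
  intro J _ _ _
  refine ExtAcyclic.of_coresolving
    (fun W ↦ ∃ Z : ModuleCat.{u} R, P Z ∧ W = .of R (Z →ₗ[R] J)) ?_ ⟨Z, hZ, rfl⟩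
  rintro _ ⟨Z, hZ, rfl⟩
  obtain ⟨S, Z', f, g, hs, hS, hf, hZ'⟩ := h Z hZ
  exact ⟨.of R (S →ₗ[R] J), .of R (Z' →ₗ[R] J), _, _, hs.dual J, hS J,
    lcomp_comp_surjective hf, Z', hZ', rfl⟩

theorem ExtAcyclic.flip_hom {J : Type u} [AddCommGroup J] [Module R J] [Module.Injective R J]
    (h : ExtAcyclic R A (B →ₗ[R] J)) : ExtAcyclic R B (A →ₗ[R] J) := by
  refine ExtAcyclic.of_coresolving (fun W ↦ ∃ A : ModuleCat.{u} R,
    ExtAcyclic R A (B →ₗ[R] J) ∧ W = .of R (A →ₗ[R] J)) ?_ ⟨.of R A, h, rfl⟩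
  rintro _ ⟨A, hA, rfl⟩
  obtain ⟨K, P, f, g, hs, hP⟩ := exists_free_presentation (R := R) A
  have : Module.Projective R P := .of_free
  refine ⟨.of R (P →ₗ[R] J), .of R (K →ₗ[R] J), _, _, hs.dual J,
    .of_injective _ _, fun k ↦ ?_, K, hs.extAcyclic_sub (.of_projective _ _) hA, rfl⟩
  obtain ⟨l, hl⟩ := hs.comp_left_surjective hA (LinearMap.flip k)
  exact ⟨LinearMap.flip l, LinearMap.ext fun b ↦ LinearMap.ext fun x ↦
    LinearMap.congr_fun (LinearMap.congr_fun hl x) b⟩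

theorem TorAcyclic.symm (h : TorAcyclic R A B) : TorAcyclic R B A :=
  fun J _ _ _ ↦ (h J).flip_hom

end TorAcyclic

/-! ### Relative Gorenstein modules -/

section Extensions

variable {R : Type u} [Ring R]

theorem IsShortExact.of_shortExact {S : ShortComplex (ModuleCat.{u} R)} (h : S.ShortExact) :
    IsShortExact S.f.hom S.g.hom where
  injective := (ModuleCat.mono_iff_injective _).1 h.mono_f
  exact := (ShortComplex.ShortExact.moduleCat_exact_iff_function_exact S).1 h.exact
  surjective := (ModuleCat.epi_iff_surjective _).1 h.epi_g

theorem IsShortExact.prop_mid {P : ObjectProperty (ModuleCat.{u} R)}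
    [P.IsClosedUnderExtensions] {X Y Z : Type u} [AddCommGroup X] [Module R X] [AddCommGroup Y]
    [Module R Y] [AddCommGroup Z] [Module R Z] {f : X →ₗ[R] Y} {g : Y →ₗ[R] Z}
    (h : IsShortExact f g) (hX : P (.of R X)) (hZ : P (.of R Z)) : P (.of R Y) :=
  P.prop_X₂_of_shortExact h.shortExact hX hZ

end Extensions

section RelGorenstein

variable {R : Type u} [CommRing R]

variable (R) in
/-- The class of flat `R`-modules. -/
abbrev flatModules : ObjectProperty (ModuleCat.{u} R) := fun F ↦ Module.Flat R F

variable (R) in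
/-- The class of injective `R`-modules. -/
abbrev injectiveModules : ObjectProperty (ModuleCat.{u} R) := fun I ↦ Module.Injective R I

/-- The modules that are Gorenstein with respect to a class `𝒰` of test modules and a class `ℱ`
of coresolving modules. A doubly infinite complex is avoided by a coinductive description: this
is the largest class of modules which are `Tor`-acyclic against `𝒰` and embed into a module of
`ℱ` with quotient again in the class. For injective test modules and flat coresolving modules
these are the Gorenstein flat modules. -/
def RelGorenstein (𝒰 ℱ : ObjectProperty (ModuleCat.{u} R)) : ObjectProperty (ModuleCat.{u} R) :=
  fun N ↦ ∃ P : ObjectProperty (ModuleCat.{u} R), P N ∧ ∀ A, P A →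
    (∀ U, 𝒰 U → TorAcyclic R U A) ∧
      ∃ (F K : ModuleCat.{u} R) (f : A →ₗ[R] F) (g : F →ₗ[R] K), IsShortExact f g ∧ ℱ F ∧ P K

/-- The modules `Y` with an exact sequence `0 → K → Eₖ₋₁ → ⋯ → E₀ → Y → 0` in which the `Eᵢ` are
injective and `Y`, `K` and all intermediate syzygies are `Ext(U, -)`-acyclic for `U` in `𝒰`. -/
def HasInjectiveLeftResolution (𝒰 : ObjectProperty (ModuleCat.{u} R)) :
    ℕ → ObjectProperty (ModuleCat.{u} R)
  | 0, Y => ∀ U, 𝒰 U → ExtAcyclic R U Y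
  | k + 1, Y => (∀ U, 𝒰 U → ExtAcyclic R U Y) ∧
      ∃ (K E : ModuleCat.{u} R) (f : K →ₗ[R] E) (g : E →ₗ[R] Y), IsShortExact f g ∧
        Module.Injective R E ∧ HasInjectiveLeftResolution 𝒰 k K

variable {𝒰 𝒱 ℱ : ObjectProperty (ModuleCat.{u} R)}

namespace RelGorenstein

theorem torAcyclic {N : ModuleCat.{u} R} (h : RelGorenstein 𝒰 ℱ N) {U : ModuleCat.{u} R}
    (hU : 𝒰 U) : TorAcyclic R U N := by
  obtain ⟨P, hN, hP⟩ := h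
  exact (hP N hN).1 U hU

theorem exists_isShortExact {N : ModuleCat.{u} R} (h : RelGorenstein 𝒰 ℱ N) :
    ∃ (F K : ModuleCat.{u} R) (f : N →ₗ[R] F) (g : F →ₗ[R] K), IsShortExact f g ∧ ℱ F ∧
      RelGorenstein 𝒰 ℱ K := by
  obtain ⟨P, hN, hP⟩ := h
  obtain ⟨F, K, f, g, hs, hF, hK⟩ := (hP N hN).2
  exact ⟨F, K, f, g, hs, hF, P, hK, hP⟩

theorem mono {N : ModuleCat.{u} R} (h : RelGorenstein 𝒰 ℱ N) (hle : 𝒱 ≤ 𝒰) :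
    RelGorenstein 𝒱 ℱ N := by
  obtain ⟨P, hN, hP⟩ := h
  exact ⟨P, hN, fun A hA ↦ ⟨fun U hU ↦ (hP A hA).1 U (hle U hU), (hP A hA).2⟩⟩

theorem congr {N N' : ModuleCat.{u} R} (h : RelGorenstein 𝒰 ℱ N) (e : N ≃ₗ[R] N') :
    RelGorenstein 𝒰 ℱ N' := by
  refine ⟨fun A ↦ ∃ N : ModuleCat.{u} R, RelGorenstein 𝒰 ℱ N ∧ Nonempty (N ≃ₗ[R] A),
    ⟨N, h, ⟨e⟩⟩, ?_⟩
  rintro A ⟨N, hN, ⟨e⟩⟩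
  obtain ⟨F, K, f, g, hs, hF, hK⟩ := hN.exists_isShortExact
  exact ⟨fun U hU ↦ (hN.torAcyclic hU).congr_right e, F, K, f ∘ₗ e.symm, g,
    hs.of_ladder_equiv e (.refl R F) (by ext; simp) (by ext; simp), hF, K, hK, ⟨.refl R K⟩⟩

end RelGorenstein

theorem injective_prod (E E' : Type u) [AddCommGroup E] [Module R E] [AddCommGroup E']
    [Module R E'] [hE : Module.Injective R E] [hE' : Module.Injective R E'] :
    Module.Injective R (E × E') where
  out X Y _ _ _ _ f hf g := by
    obtain ⟨a, ha⟩ := hE.out f hf (LinearMap.fst R E E' ∘ₗ g)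
    obtain ⟨b, hb⟩ := hE'.out f hf (LinearMap.snd R E E' ∘ₗ g)
    exact ⟨a.prod b, fun x ↦ Prod.ext (ha x) (hb x)⟩

namespace HasInjectiveLeftResolution

theorem extAcyclic {k : ℕ} {Y : ModuleCat.{u} R} (h : HasInjectiveLeftResolution 𝒰 k Y)
    {U : ModuleCat.{u} R} (hU : 𝒰 U) : ExtAcyclic R U Y := by
  cases k with
  | zero => exact h U hU
  | succ k => exact h.1 U hU

theorem of_injective (k : ℕ) (E : ModuleCat.{u} R) [Module.Injective R E] :
    HasInjectiveLeftResolution 𝒰 k E := by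
  induction k generalizing E with
  | zero => exact fun U _ ↦ .of_injective _ _
  | succ k ih =>
    have : Module.Injective R (ModuleCat.of R PUnit.{u + 1}) := injective_of_subsingleton _
    exact ⟨fun U _ ↦ .of_injective _ _, .of R PUnit, E, 0, LinearMap.id,
      .zero_equiv (.refl R E), ‹_›, ih _⟩

variable (h𝒰 : injectiveModules R ≤ 𝒰) {k : ℕ} {X Y Z : Type u} [AddCommGroup X] [Module R X]
  [AddCommGroup Y] [Module R Y] [AddCommGroup Z] [Module R Z] {a : X →ₗ[R] Y} {b : Y →ₗ[R] Z}

include h𝒰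

theorem mid (h : IsShortExact a b) (hX : HasInjectiveLeftResolution 𝒰 k (.of R X))
    (hZ : HasInjectiveLeftResolution 𝒰 k (.of R Z)) :
    HasInjectiveLeftResolution 𝒰 k (.of R Y) := by
  induction k generalizing X Y Z with
  | zero => exact fun U hU ↦ h.extAcyclic_mid (hX U hU) (hZ U hU)
  | succ k ih =>
    refine ⟨fun U hU ↦ h.extAcyclic_mid (hX.1 U hU) (hZ.1 U hU), ?_⟩
    obtain ⟨hX, K₁, E₁, i₁, p₁, h₁, hE₁, hK₁⟩ := hX
    obtain ⟨-, K₂, E₂, i₂, p₂, h₂, hE₂, hK₂⟩ := hZ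
    obtain ⟨q, hq⟩ := h.comp_right_surjective (hX E₂ (h𝒰 _ hE₂)) p₂
    obtain ⟨hs, c, d, hs'⟩ := h.exists_horseshoe h₁ h₂ q hq
    exact ⟨.of R _, .of R (E₁ × E₂), _, _, .subtype_ker_self hs, injective_prod _ _,
      ih hs' hK₁ hK₂⟩

theorem right [Module.Injective R X] (h : IsShortExact a b)
    (hY : HasInjectiveLeftResolution 𝒰 k (.of R Y)) :
    HasInjectiveLeftResolution 𝒰 k (.of R Z) := by
  cases k with
  | zero => exact fun U hU ↦ h.extAcyclic_right (.of_injective _ _) (hY U hU)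
  | succ k =>
    refine ⟨fun U hU ↦ h.extAcyclic_right (.of_injective _ _) (hY.1 U hU), ?_⟩
    obtain ⟨-, K, E, i, p, h', hE, hK⟩ := hY
    obtain ⟨c, d, hs⟩ := h.exists_ker_comp h'
    exact ⟨.of R _, E, _, b ∘ₗ p, .subtype_ker_self (h.surjective.comp h'.surjective), hE,
      mid h𝒰 hs hK (of_injective k (.of R X))⟩

theorem left [Module.Injective R Y] (h : IsShortExact a b)
    (hX : ∀ I : ModuleCat.{u} R, Module.Injective R I → ExtAcyclic R I X)
    (hZ : HasInjectiveLeftResolution 𝒰 (k + 1) (.of R Z)) :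
    HasInjectiveLeftResolution 𝒰 k (.of R X) := by
  obtain ⟨-, K, E, i, p, h', hE, hK⟩ := hZ
  obtain ⟨s, hs⟩ := h.comp_right_surjective (hX E hE) p
  obtain ⟨_, _, _, _, h₁, h₂⟩ := h'.exists_schanuel h s hs
  exact right h𝒰 h₂ (mid h𝒰 h₁ hK (of_injective k (.of R Y)))

end HasInjectiveLeftResolution

namespace RelGorenstein

theorem hasInjectiveLeftResolution_hom {N : ModuleCat.{u} R}
    (h : RelGorenstein 𝒰 (flatModules R) N) (k : ℕ) (J : Type u) [AddCommGroup J] [Module R J]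
    [Module.Injective R J] : HasInjectiveLeftResolution 𝒰 k (.of R (N →ₗ[R] J)) := by
  induction k generalizing N with
  | zero => exact fun U hU ↦ h.torAcyclic hU J
  | succ k ih =>
    obtain ⟨F, K, f, g, hs, hF, hK⟩ := h.exists_isShortExact
    exact ⟨fun U hU ↦ h.torAcyclic hU J, .of R (K →ₗ[R] J), .of R (F →ₗ[R] J), _, _, hs.dual J,
      injective_hom_of_flat F J, ih hK⟩

theorem isClosedUnderExtensions_of_injectiveModules_le (h𝒰 : injectiveModules R ≤ 𝒰)
    [(RelGorenstein (injectiveModules R) (flatModules R)).IsClosedUnderExtensions] :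
    (RelGorenstein 𝒰 (flatModules R)).IsClosedUnderExtensions where
  prop_X₂_of_shortExact {S} hS hX hZ := by
    have h := IsShortExact.of_shortExact hS
    refine ⟨fun A ↦ RelGorenstein (injectiveModules R) (flatModules R) A ∧
      ∀ (k : ℕ) (J : ModuleCat.{u} R), Module.Injective R J →
        HasInjectiveLeftResolution 𝒰 k (.of R (A →ₗ[R] J)),
      ⟨h.prop_mid (hX.mono h𝒰) (hZ.mono h𝒰), fun k J _ ↦ .mid h𝒰 (h.dual J)
        (hZ.hasInjectiveLeftResolution_hom k J) (hX.hasInjectiveLeftResolution_hom k J)⟩, ?_⟩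
    rintro A ⟨hA, hA'⟩
    refine ⟨fun U hU J _ _ _ ↦ (hA' 0 (.of R J) ‹_›).extAcyclic hU, ?_⟩
    obtain ⟨F, K, f, g, hs, hF, hK⟩ := hA.exists_isShortExact
    exact ⟨F, K, f, g, hs, hF, hK, fun k J _ ↦ .left h𝒰 (hs.dual J)
      (fun I hI ↦ hK.torAcyclic hI J) (hA' (k + 1) J ‹_›)⟩

theorem of_coresolving [(RelGorenstein 𝒰 ℱ).IsClosedUnderExtensions]
    (P : ObjectProperty (ModuleCat.{u} R))
    (hP : ∀ Z, P Z → (∀ U, 𝒰 U → TorAcyclic R U Z) ∧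
      ∃ (S Z' : ModuleCat.{u} R) (f : Z →ₗ[R] S) (g : S →ₗ[R] Z'), IsShortExact f g ∧
        RelGorenstein 𝒰 ℱ S ∧ P Z') {N : ModuleCat.{u} R} (hN : P N) : RelGorenstein 𝒰 ℱ N := by
  refine ⟨fun A ↦ ∃ (S Z : ModuleCat.{u} R) (f : A →ₗ[R] S) (g : S →ₗ[R] Z), IsShortExact f g ∧
    RelGorenstein 𝒰 ℱ S ∧ P Z, (hP N hN).2, ?_⟩
  rintro A ⟨S, Z, f, g, hs, hS, hZ⟩
  obtain ⟨hZ₀, S', Z', f', g', hs', hS', hZ'⟩ := hP Z hZ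
  refine ⟨fun U hU ↦ hs.torAcyclic_left (hS.torAcyclic hU) (hZ₀ U hU), ?_⟩
  obtain ⟨F, K, i, p, h, hF, hK⟩ := hS.exists_isShortExact
  obtain ⟨a, b, hab⟩ := hs.exists_coker_comp h
  obtain ⟨_, _, c, d, h₁, h₂⟩ := hab.exists_pushout hs'
  exact ⟨F, .of R _, i ∘ₗ f, _, .self_mkQ_range (h.injective.comp hs.injective), hF,
    .of R _, Z', c, d, h₂, h₁.prop_mid hS' hK, hZ'⟩

end RelGorenstein

end RelGorenstein

/-! ### Doubly infinite exact sequences -/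

theorem IsShortExact.exact_splice {R X Y Z W V : Type*} [Ring R] [AddCommGroup X] [Module R X]
    [AddCommGroup Y] [Module R Y] [AddCommGroup Z] [Module R Z] [AddCommGroup W] [Module R W]
    [AddCommGroup V] [Module R V] {f : X →ₗ[R] Y} {g : Y →ₗ[R] Z} (h : IsShortExact f g)
    {p : W →ₗ[R] X} (hp : Function.Surjective p) {i : Z →ₗ[R] V} (hi : Function.Injective i) :
    Function.Exact (f ∘ₗ p) (i ∘ₗ g) := by
  intro y
  rw [LinearMap.comp_apply, map_eq_zero_iff i hi, h.exact y, LinearMap.coe_comp,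
    hp.range_comp]

namespace ExactSeq

section Images

variable {R : Type u} [CommRing R] (S : ExactSeq R)

theorem isShortExact (i : ℤ) :
    IsShortExact (LinearMap.range (S.d i)).subtype (S.d (i + 1)).rangeRestrict :=
  .subtype_range_rangeRestrict (S.exact i)

variable {S} {A : Type u} [AddCommGroup A] [Module R A]

theorem TensorExact.lTensor_subtype_injective (h : S.TensorExact A) (i : ℤ) :
    Function.Injective ((LinearMap.range (S.d i)).subtype.lTensor A) := by
  obtain ⟨i, rfl⟩ : ∃ j, i = j + 1 := ⟨i - 1, by ring⟩
  rw [injective_iff_map_eq_zero]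
  intro t ht
  obtain ⟨y, rfl⟩ := LinearMap.lTensor_surjective A (S.d (i + 1)).surjective_rangeRestrict t
  rw [← LinearMap.lTensor_comp_apply] at ht
  obtain ⟨x, rfl⟩ := (h i y).1 ht
  have h₀ : (S.d (i + 1)).rangeRestrict ∘ₗ S.d i = 0 :=
    LinearMap.ext fun x ↦ Subtype.ext ((S.exact i).apply_apply_eq_zero x)
  rw [← LinearMap.lTensor_comp_apply, h₀, LinearMap.lTensor_zero, LinearMap.zero_apply]

theorem HomExact.comp_rangeRestrict_surjective (h : S.HomExact A) (i : ℤ) :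
    Function.Surjective fun l : A →ₗ[R] S.X (i + 1) ↦ (S.d (i + 1)).rangeRestrict ∘ₗ l := by
  intro k
  obtain ⟨l, hl⟩ := (h (i + 1) ((LinearMap.range (S.d (i + 1))).subtype ∘ₗ k)).1
    (LinearMap.ext fun a ↦
      congrArg Subtype.val ((S.isShortExact (i + 1)).exact.apply_apply_eq_zero (k a)))
  exact ⟨l, LinearMap.ext fun a ↦ Subtype.ext (LinearMap.congr_fun hl a)⟩

theorem TensorExact.torAcyclic_range (h : S.TensorExact A) {n : ℤ}
    (hX : ∀ i ≤ n, TorAcyclic R A (S.X i)) {i : ℤ} (hi : i ≤ n) :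
    TorAcyclic R A (LinearMap.range (S.d i)) := by
  refine TorAcyclic.of_resolving (fun Z ↦ ∃ i ≤ n, Z = .of R (LinearMap.range (S.d i))) ?_
    ⟨i, hi, rfl⟩
  rintro _ ⟨i, hi, rfl⟩
  obtain ⟨i, rfl⟩ : ∃ j, i = j + 1 := ⟨i - 1, by ring⟩
  exact ⟨S.X (i + 1), .of R (LinearMap.range (S.d i)), _, _, S.isShortExact i, hX _ hi,
    h.lTensor_subtype_injective i, i, by lia, rfl⟩

theorem relGorenstein {𝒰 ℱ : ObjectProperty (ModuleCat.{u} R)}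
    (hX : ∀ i U, 𝒰 U → TorAcyclic R U (S.X i)) (hF : ∀ i, 1 ≤ i → ℱ (S.X i))
    (hU : ∀ U, 𝒰 U → S.TensorExact U) {N : ModuleCat.{u} R} (hN : S.HasImage N) :
    RelGorenstein 𝒰 ℱ N := by
  obtain ⟨e⟩ := hN
  refine RelGorenstein.congr (N := .of R (LinearMap.range (S.d 0))) ?_ e.symm
  refine ⟨fun A ↦ ∃ i, 0 ≤ i ∧ A = .of R (LinearMap.range (S.d i)), ⟨0, le_rfl, rfl⟩, ?_⟩
  rintro _ ⟨i, hi, rfl⟩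
  exact ⟨fun U h ↦ (hU U h).torAcyclic_range (fun j _ ↦ hX j U h) le_rfl,
    S.X (i + 1), .of R (LinearMap.range (S.d (i + 1))), _, _, S.isShortExact i,
    hF _ (by lia), i + 1, by lia, rfl⟩

end Images

section Splice

variable {R : Type u} [CommRing R]

/-- The exact sequence spliced from short exact sequences `0 → Z i → X i → Z (i + 1) → 0`. The
image of its map `X i → X (i + 1)` is `Z (i + 1)`. -/
def splice (Z X : ℤ → ModuleCat.{u} R) (ι : ∀ i, Z i →ₗ[R] X i)
    (π : ∀ i, X i →ₗ[R] Z (i + 1)) (h : ∀ i, IsShortExact (ι i) (π i)) : ExactSeq R where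
  X := X
  d i := ι (i + 1) ∘ₗ π i
  exact i := (h (i + 1)).exact_splice (h i).surjective (h (i + 1 + 1)).injective

variable {Z X : ℤ → ModuleCat.{u} R} {ι : ∀ i, Z i →ₗ[R] X i}
  {π : ∀ i, X i →ₗ[R] Z (i + 1)} (h : ∀ i, IsShortExact (ι i) (π i))
  {A : Type u} [AddCommGroup A] [Module R A]

theorem splice_hasImage : (splice Z X ι π h).HasImage (Z 1) := by
  have hr : LinearMap.range ((splice Z X ι π h).d 0) = LinearMap.range (ι 1) :=
    LinearMap.range_comp_of_range_eq_top _ (LinearMap.range_eq_top.2 (h 0).surjective)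
  exact ⟨(LinearEquiv.ofInjective _ (h 1).injective).trans (LinearEquiv.ofEq _ _ hr.symm)⟩

theorem splice_tensorExact (hι : ∀ i, Function.Injective ((ι i).lTensor A)) :
    (splice Z X ι π h).TensorExact A := by
  intro i
  have := ((h (i + 1)).lTensor (hι (i + 1))).exact_splice
    (LinearMap.lTensor_surjective A (h i).surjective) (hι (i + 1 + 1))
  rwa [← LinearMap.lTensor_comp, ← LinearMap.lTensor_comp] at this

theorem splice_homExact (hπ : ∀ i, Function.Surjective fun l : A →ₗ[R] X i ↦ π i ∘ₗ l) :
    (splice Z X ι π h).HomExact A := fun i ↦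
  ((h (i + 1)).hom (hπ (i + 1))).exact_splice (p := (π i).compRight R)
    (i := (ι (i + 1 + 1)).compRight R) (hπ i) ((h (i + 1 + 1)).hom (hπ (i + 1 + 1))).injective

end Splice

end ExactSeq

theorem exists_int_chain {α : Type*} {r s : α → α → Prop} {P Q : α → Prop}
    (hP : ∀ a, P a → ∃ b, r a b ∧ P b) (hQ : ∀ a, Q a → ∃ b, s b a ∧ Q b) {a : α}
    (ha : P a) (ha' : Q a) : ∃ W : ℤ → α, W 1 = a ∧ (∀ i, 1 ≤ i → r (W i) (W (i + 1))) ∧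
      ∀ i ≤ 0, s (W i) (W (i + 1)) := by
  choose! f hf hfP using hP
  choose! g hg hgQ using hQ
  let V : ℤ → α := Int.rec (fun n ↦ f^[n] a) fun n ↦ g^[n + 1] a
  have hV (n : ℕ) : r (V n) (V (n + 1)) := by
    change r (f^[n] a) (f^[n + 1] a)
    rw [Function.iterate_succ_apply']
    exact hf _ (Function.Iterate.rec P ha hfP n)
  have hV' (n : ℕ) : s (V (Int.negSucc n)) (V (Int.negSucc n + 1)) := by
    have hn : V (Int.negSucc n + 1) = g^[n] a := by cases n <;> rfl
    change s (g^[n + 1] a) _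
    rw [hn, Function.iterate_succ_apply']
    exact hg _ (Function.Iterate.rec Q ha' hgQ n)
  refine ⟨fun i ↦ V (i - 1), rfl, fun i hi ↦ ?_, fun i hi ↦ ?_⟩ <;> dsimp only <;>
    rw [show i + 1 - 1 = i - 1 + 1 by ring]
  · lift i - 1 to ℕ using by lia with n
    exact hV n
  · obtain ⟨n, hn⟩ := Int.eq_negSucc_of_lt_zero (show i - 1 < 0 by lia)
    rw [hn]
    exact hV' n

section Construction

variable {R : Type u} [CommRing R] {𝒰 ℱ 𝒳 : ObjectProperty (ModuleCat.{u} R)}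

theorem RelGorenstein.exists_exactSeq {N : ModuleCat.{u} R} (h : RelGorenstein 𝒰 ℱ N) :
    ∃ S : ExactSeq R, (∀ i : ℤ, i ≤ 0 → Module.Flat R (S.X i)) ∧ (∀ i : ℤ, 1 ≤ i → ℱ (S.X i)) ∧
      S.HasImage N ∧ ∀ U, 𝒰 U → S.TensorExact U := by
  let extendsBy (𝒢 : ObjectProperty (ModuleCat.{u} R)) (A B : ModuleCat.{u} R) : Prop :=
    ∃ (E : ModuleCat.{u} R) (f : A →ₗ[R] E) (g : E →ₗ[R] B), IsShortExact f g ∧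
      𝒢 E ∧ ∀ U, 𝒰 U → Function.Injective (f.lTensor U)
  have h_next (A) (hA : RelGorenstein 𝒰 ℱ A) : ∃ B, extendsBy ℱ A B ∧ RelGorenstein 𝒰 ℱ B := by
    obtain ⟨F, K, f, g, hs, hF, hK⟩ := hA.exists_isShortExact
    exact ⟨K, ⟨F, f, g, hs, hF, fun U hU ↦ hs.lTensor_injective (hK.torAcyclic hU)⟩, hK⟩
  have h_prev (A : ModuleCat.{u} R) (hA : ∀ U, 𝒰 U → TorAcyclic R U A) :
      ∃ B, extendsBy (flatModules R) B A ∧ ∀ U, 𝒰 U → TorAcyclic R U B := by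
    obtain ⟨K, F, f, g, hs, hF⟩ := exists_free_presentation (R := R) A
    exact ⟨K, ⟨F, f, g, hs, inferInstance, fun U hU ↦ hs.lTensor_injective (hA U hU)⟩,
      fun U hU ↦ hs.torAcyclic_left (.of_flat _ _) (hA U hU)⟩
  obtain ⟨W, rfl, hr, hs⟩ := exists_int_chain h_next h_prev h fun U hU ↦ h.torAcyclic hU
  have hW (i : ℤ) : extendsBy (fun E ↦ (i ≤ 0 → Module.Flat R E) ∧ (1 ≤ i → ℱ E))
      (W i) (W (i + 1)) := by
    rcases le_or_gt i 0 with hi | hi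
    · obtain ⟨E, f, g, hs, hE, hU⟩ := hs i hi
      exact ⟨E, f, g, hs, ⟨fun _ ↦ hE, fun h ↦ by lia⟩, hU⟩
    · obtain ⟨E, f, g, hs, hE, hU⟩ := hr i hi
      exact ⟨E, f, g, hs, ⟨fun h ↦ by lia, fun _ ↦ hE⟩, hU⟩
  choose X ι π hS hX hU using hW
  exact ⟨.splice W X ι π hS, fun i ↦ (hX i).1, fun i ↦ (hX i).2, ExactSeq.splice_hasImage hS,
    fun U h ↦ ExactSeq.splice_tensorExact hS fun i ↦ hU i U h⟩

variable (R) in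
theorem gorensteinFlat_eq_relGorenstein :
    GorensteinFlat R = RelGorenstein (injectiveModules R) (flatModules R) := by
  ext N
  constructor
  · rintro ⟨S, hS, hN, hU⟩
    exact S.relGorenstein (fun i _ _ ↦ have := hS i; .of_flat _ _) (fun i _ ↦ hS i)
      (fun U h ↦ hU U h) hN
  · intro h
    obtain ⟨S, hS, hS', hN, hU⟩ := h.exists_exactSeq
    exact ⟨S, fun i ↦ (le_or_gt i 0).elim (hS i) (hS' i), hN, fun I _ _ ↦ hU (.of R I)⟩

theorem IsGFClosed.relGorenstein (hR : IsGFClosed R) (h𝒰 : injectiveModules R ≤ 𝒰) :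
    (RelGorenstein 𝒰 (flatModules R)).IsClosedUnderExtensions := by
  rw [IsGFClosed, gorensteinFlat_eq_relGorenstein] at hR
  exact RelGorenstein.isClosedUnderExtensions_of_injectiveModules_le h𝒰

theorem le_gorStep {O : ModuleCat.{u} R} (hO : 𝒳 O) [Subsingleton O] : 𝒳 ≤ gorStep 𝒳 := by
  let splitBy (A B : ModuleCat.{u} R) : Prop :=
    ∃ (E : ModuleCat.{u} R) (f : A →ₗ[R] E) (g : E →ₗ[R] B) (s : B →ₗ[R] E) (r : E →ₗ[R] A),
      IsShortExact f g ∧ 𝒳 E ∧ g ∘ₗ s = LinearMap.id ∧ r ∘ₗ f = LinearMap.id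
  have h_next (A) (hA : 𝒳 A) : ∃ B, splitBy A B ∧ 𝒳 B :=
    ⟨O, ⟨A, LinearMap.id, 0, 0, LinearMap.id, .equiv_zero (.refl R A), hA,
      LinearMap.ext fun _ ↦ Subsingleton.elim _ _, rfl⟩, hO⟩
  have h_prev (A) (hA : 𝒳 A) : ∃ B, splitBy B A ∧ 𝒳 B :=
    ⟨O, ⟨A, 0, LinearMap.id, LinearMap.id, 0, .zero_equiv (.refl R A), hA, rfl,
      LinearMap.ext fun _ ↦ Subsingleton.elim _ _⟩, hO⟩
  intro M hM
  obtain ⟨W, rfl, hr, hs⟩ := exists_int_chain h_next h_prev hM hM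
  have hW (i : ℤ) : splitBy (W i) (W (i + 1)) := (le_or_gt i 0).elim (hs i) (hr i)
  choose X ι π s r hS hX hs hr using hW
  refine ⟨.splice W X ι π hS, hX, ExactSeq.splice_hasImage hS,
    fun A _ ↦ ExactSeq.splice_homExact hS fun i k ↦ ⟨s i ∘ₗ k, ?_⟩,
    fun A _ ↦ ExactSeq.splice_tensorExact hS fun i ↦ ?_⟩
  · dsimp only
    rw [← LinearMap.comp_assoc, hs, LinearMap.id_comp]
  · refine Function.LeftInverse.injective (g := (r i).lTensor _) fun x ↦ ?_
    rw [← LinearMap.lTensor_comp_apply, hr, LinearMap.lTensor_id_apply]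

end Construction

/-! ### Vanishing of Tor and evaluation maps -/

section Tor

variable {R : Type u} [CommRing R]

theorem exact_projectiveResolution_zero {A : ModuleCat.{u} R} (P : ProjectiveResolution A) :
    Function.Exact (P.complex.d 1 0).hom (P.π.f 0).hom :=
  (ShortComplex.ShortExact.moduleCat_exact_iff_function_exact _).1 <|
    (ShortComplex.mk _ _ P.complex_d_comp_π_f_zero).exact_of_g_is_cokernel
      P.isColimitCokernelCofork

theorem exists_syzygies {A : ModuleCat.{u} R} (P : ProjectiveResolution A) :
    ∃ (K : ℕ → ModuleCat.{u} R) (ι : ∀ n, K (n + 1) →ₗ[R] P.complex.X n)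
      (π : ∀ n, P.complex.X n →ₗ[R] K n), K 0 = A ∧ (∀ n, IsShortExact (ι n) (π n)) ∧
      ∀ n, (P.complex.d (n + 1) n).hom = ι n ∘ₗ π (n + 1) := by
  let K : ℕ → ModuleCat.{u} R
    | 0 => A
    | n + 1 => .of R (LinearMap.range (P.complex.d (n + 1) n).hom)
  let π : ∀ n, P.complex.X n →ₗ[R] K n
    | 0 => (P.π.f 0).hom
    | n + 1 => (P.complex.d (n + 1) n).hom.rangeRestrict
  refine ⟨K, fun n ↦ (LinearMap.range (P.complex.d (n + 1) n).hom).subtype, π, rfl,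
    fun n ↦ ?_, fun _ ↦ rfl⟩
  cases n with
  | zero =>
    exact .subtype_range (exact_projectiveResolution_zero P)
      ((ModuleCat.epi_iff_surjective _).1 (inferInstanceAs (Epi (P.π.f 0))))
  | succ n =>
    exact .subtype_range_rangeRestrict
      ((ShortComplex.ShortExact.moduleCat_exact_iff_function_exact _).1 (P.exact_succ n))

theorem isZero_tor_succ_iff {A : ModuleCat.{u} R} (P : ProjectiveResolution A)
    (C : Type u) [AddCommGroup C] [Module R C] (n : ℕ) :
    Limits.IsZero (((Tor (ModuleCat.{u} R) (n + 1)).obj (.of R C)).obj A) ↔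
      Function.Exact ((P.complex.d (n + 2) (n + 1)).hom.lTensor C)
        ((P.complex.d (n + 1) n).hom.lTensor C) := by
  let F := (MonoidalCategory.tensoringLeft (ModuleCat.{u} R)).obj (.of R C)
  rw [show ((Tor (ModuleCat.{u} R) (n + 1)).obj (.of R C)).obj A =
    (F.leftDerived (n + 1)).obj A from rfl, (P.isoLeftDerivedObj F (n + 1)).isZero_iff]
  change Limits.IsZero (HomologicalComplex.homology _ _) ↔ _
  rw [← HomologicalComplex.exactAt_iff_isZero_homology,
    HomologicalComplex.exactAt_iff' _ (n + 2) (n + 1) n (by simp)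
      (by simp only [ChainComplex.next_nat_succ]),
    ShortComplex.ShortExact.moduleCat_exact_iff_function_exact]
  exact Iff.rfl

theorem IsShortExact.exact_lTensor_splice_iff {C X Y Z W V : Type*} [AddCommGroup C] [Module R C]
    [AddCommGroup X] [Module R X] [AddCommGroup Y] [Module R Y] [AddCommGroup Z] [Module R Z]
    [AddCommGroup W] [Module R W] [AddCommGroup V] [Module R V] {f : X →ₗ[R] Y} {g : Y →ₗ[R] Z}
    (h : IsShortExact f g) {p : W →ₗ[R] X} (hp : Function.Surjective p) {i : Z →ₗ[R] V} :
    Function.Exact ((f ∘ₗ p).lTensor C) ((i ∘ₗ g).lTensor C) ↔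
      Function.Injective (i.lTensor C) := by
  rw [LinearMap.lTensor_comp, LinearMap.lTensor_comp,
    (LinearMap.lTensor_surjective C hp).comp_exact_iff_exact]
  have hex := lTensor_exact C h.exact h.surjective
  refine ⟨fun hi ↦ (injective_iff_map_eq_zero _).2 fun t ht ↦ ?_,
    fun hi ↦ hi.comp_exact_iff_exact.2 hex⟩
  obtain ⟨y, rfl⟩ := LinearMap.lTensor_surjective C h.surjective t
  exact (hex y).2 ((hi y).1 ht)

theorem isZero_tor_iff {A C : Type u} [AddCommGroup C] [Module R C] [AddCommGroup A]
    [Module R A] :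
    (∀ n : ℕ, 1 ≤ n → Limits.IsZero
      (((Tor (ModuleCat.{u} R) n).obj (.of R C)).obj (.of R A))) ↔ TorAcyclic R C A := by
  let P := projectiveResolution (ModuleCat.of R A)
  obtain ⟨K, ι, π, hK, hs, hd⟩ := exists_syzygies P
  have hflat (n) : Module.Flat R (P.complex.X n) := by
    have : Module.Projective R (P.complex.X n) :=
      (IsProjective.iff_projective _).2 (P.projective n)
    infer_instance
  have htor (n) : Limits.IsZero (((Tor (ModuleCat.{u} R) (n + 1)).obj (.of R C)).obj (.of R A)) ↔
      Function.Injective ((ι n).lTensor C) := by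
    rw [isZero_tor_succ_iff P, hd, hd,
      (hs (n + 1)).exact_lTensor_splice_iff (hs (n + 2)).surjective]
  have hT : TorAcyclic R C (K 0) ↔ TorAcyclic R C A := by rw [hK]
  rw [← hT]
  constructor
  · intro h
    refine .of_resolving (fun Z ↦ ∃ n, Z = K n) ?_ ⟨0, rfl⟩
    rintro _ ⟨n, rfl⟩
    have := hflat n
    exact ⟨_, _, _, _, hs n, .of_flat _ _, (htor n).1 (h _ (by lia)), n + 1, rfl⟩
  · intro h n hn
    have hacyclic (n) : TorAcyclic R C (K n) := by
      induction n with
      | zero => exact h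
      | succ n ih =>
        have := hflat n
        exact (hs n).torAcyclic_left (.of_flat _ _) ih
    obtain ⟨n, rfl⟩ := Nat.exists_eq_add_of_le' hn
    exact (htor n).2 ((hs n).lTensor_injective (hacyclic n))

end Tor

section FinitelyPresented

variable {R : Type u} [CommRing R] (K B I : Type u) [AddCommGroup K] [Module R K]
  [AddCommGroup B] [Module R B] [AddCommGroup I] [Module R I]

variable {K B} in
theorem lcomp_comp_lTensorHomToHomLTensor {L F : Type u} [AddCommGroup L] [Module R L]
    [AddCommGroup F] [Module R F] (p : K →ₗ[R] L) :
    p.lcomp R (F ⊗[R] B) ∘ₗ lTensorHomToHomLTensor (.id R) L F B =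
      lTensorHomToHomLTensor (.id R) K F B ∘ₗ (p.lcomp R B).lTensor F :=
  TensorProduct.ext' fun _ _ ↦ rfl

theorem lTensorHomToHomLTensor_bijective (F : Type u) [AddCommGroup F] [Module R F]
    [Module.Flat R F] [Module.FinitePresentation R K] :
    Function.Bijective (lTensorHomToHomLTensor (.id R) K F B) := by
  obtain ⟨n, m, f, g, hf, hgf⟩ := Module.FinitePresentation.exists_fin' R K
  have hfree (n : ℕ) : Function.Bijective (lTensorHomToHomLTensor (.id R) (Fin n → R) F B) := by
    rw [← lTensorHomEquivHomLTensor_toLinearMap]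
    exact LinearEquiv.bijective _
  exact LinearMap.bijective_of_bijective_of_injective_of_left_exact
    _ _ _ _ _ _ _ (lcomp_comp_lTensorHomToHomLTensor f) (lcomp_comp_lTensorHomToHomLTensor g)
    (Module.Flat.lTensor_exact F (LinearMap.exact_lcomp_of_exact_of_surjective B hgf hf))
    (LinearMap.exact_lcomp_of_exact_of_surjective _ hgf hf) (hfree n) (hfree m).injective
    (Module.Flat.lTensor_preserves_injective_linearMap _
      (LinearMap.lcomp_injective_of_surjective f hf))
    (LinearMap.lcomp_injective_of_surjective f hf)

/-- Homomorphism evaluation `Hom(B, I) ⊗ K ⟶ Hom(Hom(K, B), I)`, `φ ⊗ x ↦ (f ↦ φ (f x))`. -/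
noncomputable def homEval : (B →ₗ[R] I) ⊗[R] K →ₗ[R] (K →ₗ[R] B) →ₗ[R] I :=
  TensorProduct.lift ((LinearMap.llcomp R (K →ₗ[R] B) B I).compl₂ LinearMap.applyₗ)

variable {K B I}

@[simp]
theorem homEval_tmul (φ : B →ₗ[R] I) (x : K) (f : K →ₗ[R] B) :
    homEval K B I (φ ⊗ₜ x) f = φ (f x) := rfl

theorem homEval_comp_lTensor {L : Type u} [AddCommGroup L] [Module R L] (p : K →ₗ[R] L) :
    homEval L B I ∘ₗ p.lTensor (B →ₗ[R] I) = (p.lcomp R B).lcomp R I ∘ₗ homEval K B I :=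
  TensorProduct.ext' fun _ _ ↦ rfl

variable (K B I)

theorem homEval_bijective_pi (n : ℕ) : Function.Bijective (homEval (R := R) (Fin n → R) B I) := by
  let e := TensorProduct.piScalarRight R R (B →ₗ[R] I) (Fin n) ≪≫ₗ
    LinearMap.lsum R (fun _ : Fin n ↦ B) R ≪≫ₗ (Module.piEquiv (Fin n) R B).congrLeft I R
  have he : homEval (R := R) (Fin n → R) B I = e := by
    refine TensorProduct.ext' fun φ x ↦ LinearMap.ext fun f ↦ ?_
    obtain ⟨b, rfl⟩ := (Module.piEquiv (Fin n) R B).surjective f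
    simp [e, Module.piEquiv_apply_apply]
  rw [he]
  exact e.bijective

theorem exact_lcomp_of_injective {X Y Z : Type u} [AddCommGroup X] [Module R X] [AddCommGroup Y]
    [Module R Y] [AddCommGroup Z] [Module R Z] {f : X →ₗ[R] Y} {g : Y →ₗ[R] Z}
    (h : Function.Exact f g) [hI : Module.Injective R I] :
    Function.Exact (g.lcomp R I) (f.lcomp R I) := by
  have hr : Function.Exact f g.rangeRestrict :=
    (Subtype.val_injective.comp_exact_iff_exact (i := (LinearMap.range g).subtype)).1 h
  have hext : Function.Surjective ((LinearMap.range g).subtype.lcomp R I) := fun k ↦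
    (hI.out _ Subtype.val_injective k).imp fun _ ↦ LinearMap.ext
  exact hext.comp_exact_iff_exact.2
    (LinearMap.exact_lcomp_of_exact_of_surjective I hr g.surjective_rangeRestrict)

theorem homEval_bijective [hI : Module.Injective R I] [Module.FinitePresentation R K] :
    Function.Bijective (homEval (R := R) K B I) := by
  obtain ⟨n, m, f, g, hf, hgf⟩ := Module.FinitePresentation.exists_fin' R K
  exact LinearMap.bijective_of_surjective_of_bijective_of_right_exact
    _ _ _ _ _ _ _ (homEval_comp_lTensor g).symm (homEval_comp_lTensor f).symm
    (lTensor_exact (B →ₗ[R] I) hgf hf)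
    (exact_lcomp_of_injective I (LinearMap.exact_lcomp_of_exact_of_surjective B hgf hf))
    (homEval_bijective_pi B I m).surjective (homEval_bijective_pi B I n)
    (LinearMap.lTensor_surjective _ hf)
    fun Φ ↦ (hI.out _ (LinearMap.lcomp_injective_of_surjective f hf) Φ).imp fun _ ↦ LinearMap.ext

end FinitelyPresented

/-! ### The Bass class of a semidualizing module -/

section BassClass

variable {R : Type u} [CommRing R] {C : Type u} [AddCommGroup C] [Module R C]

theorem bass_iff {N : ModuleCat.{u} R} : Bass R C N ↔ ExtAcyclic R C N ∧
    TorAcyclic R C (C →ₗ[R] N) ∧ Function.Bijective (evalMap R C N) := by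
  rw [← isZero_tor_iff]
  rfl

@[simp]
theorem evalMap_tmul {N : Type u} [AddCommGroup N] [Module R N] (c : C) (f : C →ₗ[R] N) :
    evalMap R C N (c ⊗ₜ f) = f c := rfl

theorem evalMap_comp_lTensor {N N' : Type u} [AddCommGroup N] [Module R N] [AddCommGroup N']
    [Module R N'] (g : N →ₗ[R] N') :
    evalMap R C N' ∘ₗ (g.compRight R).lTensor C = g ∘ₗ evalMap R C N :=
  TensorProduct.ext' fun _ _ ↦ rfl

theorem lTensor_compRight_injective {X Y : Type u} [AddCommGroup X] [Module R X] [AddCommGroup Y]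
    [Module R Y] {f : X →ₗ[R] Y} (hf : Function.Injective f)
    (hX : Function.Injective (evalMap R C X)) :
    Function.Injective ((f.compRight R : (C →ₗ[R] X) →ₗ[R] C →ₗ[R] Y).lTensor C) := by
  have := hf.comp hX
  rw [← LinearMap.coe_comp, ← evalMap_comp_lTensor] at this
  exact .of_comp this

namespace IsShortExact

variable {X Y Z : Type u} [AddCommGroup X] [Module R X] [AddCommGroup Y] [Module R Y]
  [AddCommGroup Z] [Module R Z] {f : X →ₗ[R] Y} {g : Y →ₗ[R] Z}

theorem evalMap_bijective (h : IsShortExact f g)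
    (hg : Function.Surjective fun l : C →ₗ[R] Y ↦ g ∘ₗ l)
    (hX : Function.Surjective (evalMap R C X)) (hY : Function.Bijective (evalMap R C Y)) :
    Function.Bijective (evalMap R C Z) :=
  LinearMap.bijective_of_surjective_of_bijective_of_right_exact _ _ _ _ _ _ _
    (evalMap_comp_lTensor f).symm (evalMap_comp_lTensor g).symm
    (lTensor_exact C (h.hom hg).exact (h.hom hg).surjective) h.exact hX hY
    (LinearMap.lTensor_surjective C (h.hom hg).surjective) h.surjective

theorem bass_right {X Y Z : ModuleCat.{u} R} {f : X →ₗ[R] Y} {g : Y →ₗ[R] Z}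
    (h : IsShortExact f g) (hX : Bass R C X) (hY : Bass R C Y) : Bass R C Z := by
  rw [bass_iff] at *
  have hg := h.comp_right_surjective hX.1
  exact ⟨h.extAcyclic_right hX.1 hY.1,
    (h.hom hg).torAcyclic_right hX.2.1 hY.2.1
      (lTensor_compRight_injective h.injective hX.2.2.injective),
    h.evalMap_bijective hg hX.2.2.surjective hY.2.2⟩

end IsShortExact

theorem Bass.congr {X Y : ModuleCat.{u} R} (h : Bass R C X) (e : X ≃ₗ[R] Y) : Bass R C Y := by
  rw [bass_iff] at *
  refine ⟨h.1.congr_right e, h.2.1.congr_right e.congrRight, ?_⟩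
  have hcomp := e.bijective.comp h.2.2
  rw [← LinearEquiv.coe_coe, ← LinearMap.coe_comp, ← evalMap_comp_lTensor] at hcomp
  exact (Function.Bijective.of_comp_iff _
    (LinearEquiv.lTensor C (e.congrRight : (C →ₗ[R] X) ≃ₗ[R] _)).bijective).1 hcomp

end BassClass

section Semidualizing

variable {R : Type u} [CommRing R] {C : Type u} [AddCommGroup C] [Module R C]

namespace IsSemidualizing

variable (hC : IsSemidualizing R C) (F : Type u) [AddCommGroup F] [Module R F]
  [Module.Flat R F]

include hC

theorem exists_resolving : ∃ 𝒦 : ObjectProperty (ModuleCat.{u} R), 𝒦 (.of R C) ∧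
    ∀ K, 𝒦 K → Module.FinitePresentation R K ∧ ExtAcyclic R K C ∧
      ∃ (P K' : ModuleCat.{u} R) (f : K' →ₗ[R] P) (g : P →ₗ[R] K),
        IsShortExact f g ∧ Module.Projective R P ∧ 𝒦 K' := by
  obtain ⟨P, hfin⟩ := hC.exists_resolution
  obtain ⟨K, ι, π, hK, hs, -⟩ := exists_syzygies P
  have hproj (n) : Module.Projective R (P.complex.X n) :=
    (IsProjective.iff_projective _).2 (P.projective n)
  refine ⟨fun X ↦ ∃ n, X = K n, ⟨0, hK.symm⟩, ?_⟩
  rintro _ ⟨n, rfl⟩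
  refine ⟨?_, ?_, _, _, _, _, hs n, hproj n, n + 1, rfl⟩
  · have : Module.Finite R (K (n + 1)) := .of_surjective (π (n + 1)) (hs (n + 1)).surjective
    have : Module.FinitePresentation R (P.complex.X n) :=
      Module.finitePresentation_of_projective _ _
    refine Module.finitePresentation_of_surjective (π n) (hs n).surjective ?_
    rw [(hs n).exact.linearMap_ker_eq, LinearMap.range_eq_map]
    exact Module.Finite.fg_top.map _
  · induction n with
    | zero => rw [hK]; exact hC.ext_eq_zero
    | succ n ih => exact (hs n).extAcyclic_sub (.of_projective _ _) ih

theorem finitePresentation : Module.FinitePresentation R C := by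
  obtain ⟨𝒦, hmem, h𝒦⟩ := hC.exists_resolving
  exact (h𝒦 _ hmem).1

theorem extAcyclic_tensor : ExtAcyclic R C (C ⊗[R] F) := by
  refine ExtAcyclic.congr_right ?_ (TensorProduct.comm R F C)
  obtain ⟨𝒦, hmem, h𝒦⟩ := hC.exists_resolving
  refine ExtAcyclic.of_resolving 𝒦 (fun K hK ↦ ?_) hmem
  obtain ⟨-, hExt, P, K', f, g, hs, hP, hK'⟩ := h𝒦 K hK
  refine ⟨P, K', f, g, hs, .of_projective _ _, ?_, hK'⟩
  have := (h𝒦 K' hK').1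
  have hsurj : Function.Surjective (lTensorHomToHomLTensor (.id R) K' F C ∘ₗ
      (f.lcomp R C).lTensor F) :=
    (lTensorHomToHomLTensor_bijective K' C F).surjective.comp
      (LinearMap.lTensor_surjective F (hs.comp_left_surjective hExt))
  rw [← lcomp_comp_lTensorHomToHomLTensor] at hsurj
  exact .of_comp hsurj

theorem torAcyclic_hom (I : Type u) [AddCommGroup I] [Module R I] [Module.Injective R I] :
    TorAcyclic R C (C →ₗ[R] I) := by
  refine TorAcyclic.symm ?_
  obtain ⟨𝒦, hmem, h𝒦⟩ := hC.exists_resolving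
  refine TorAcyclic.of_resolving 𝒦 (fun K hK ↦ ?_) hmem
  obtain ⟨-, hExt, P, K', f, g, hs, hP, hK'⟩ := h𝒦 K hK
  refine ⟨P, K', f, g, hs, .of_flat _ _, ?_, hK'⟩
  have := (h𝒦 K' hK').1
  have hinj : Function.Injective ((f.lcomp R C).lcomp R I ∘ₗ homEval K' C I) :=
    (LinearMap.lcomp_injective_of_surjective _ (hs.comp_left_surjective hExt)).comp
      (homEval_bijective K' C I).injective
  rw [← homEval_comp_lTensor] at hinj
  exact .of_comp hinj

theorem evalMap_bijective_of_injective (I : Type u) [AddCommGroup I] [Module R I]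
    [Module.Injective R I] :    Function.Bijective (evalMap R C I) := by
  have := hC.finitePresentation
  let e : R ≃ₗ[R] (C →ₗ[R] C) := .ofBijective _ hC.homothety_bijective
  let e' : ((C →ₗ[R] C) →ₗ[R] I) ≃ₗ[R] I :=
    e.symm.congrLeft I R ≪≫ₗ LinearMap.ringLmapEquivSelf R R I
  have h : evalMap R C I = e' ∘ₗ homEval C C I ∘ₗ TensorProduct.comm R C (C →ₗ[R] I) :=
    TensorProduct.ext' fun c f ↦ by simp [e', e]
  rw [h]
  exact e'.bijective.comp ((homEval_bijective C C I).comp (LinearEquiv.bijective _))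

theorem tensor_mk_flip_bijective : Function.Bijective (TensorProduct.mk R C F).flip := by
  have := hC.finitePresentation
  let e : R ≃ₗ[R] (C →ₗ[R] C) := .ofBijective _ hC.homothety_bijective
  let e' : F ≃ₗ[R] F ⊗[R] (C →ₗ[R] C) := (TensorProduct.rid R F).symm ≪≫ₗ e.lTensor F
  let σ : (C →ₗ[R] F ⊗[R] C) ≃ₗ[R] C →ₗ[R] C ⊗[R] F :=
    (LinearEquiv.refl R C).arrowCongr (TensorProduct.comm R F C)
  have h : (TensorProduct.mk R C F).flip =
      σ ∘ₗ lTensorHomToHomLTensor (.id R) C F C ∘ₗ e' := by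
    ext x c
    simp [σ, e', e]
  rw [h]
  exact σ.bijective.comp ((lTensorHomToHomLTensor_bijective C C F).comp e'.bijective)

theorem exists_equiv_hom_tensor : ∃ e : F ≃ₗ[R] (C →ₗ[R] C ⊗[R] F), ∀ x c, e x c = c ⊗ₜ x :=
  ⟨.ofBijective _ (hC.tensor_mk_flip_bijective F), fun _ _ ↦ rfl⟩

theorem bass_tensor : Bass R C (.of R (C ⊗[R] F)) := by
  obtain ⟨e, he⟩ := hC.exists_equiv_hom_tensor F
  refine bass_iff.2 ⟨hC.extAcyclic_tensor F, .congr_right (.of_flat C F) e, ?_⟩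
  have h : evalMap R C (C ⊗[R] F) ∘ₗ e.lTensor C = LinearMap.id :=
    TensorProduct.ext' fun c x ↦ he x c
  have h' : evalMap R C (C ⊗[R] F) = (e.lTensor C).symm :=
    (LinearEquiv.eq_comp_toLinearMap_symm _ _).2 h
  change Function.Bijective (evalMap R C (C ⊗[R] F))
  rw [h']
  exact (e.lTensor C).symm.bijective

theorem torAcyclic_tensor {U : ModuleCat.{u} R} (hU : CInjective R C U) :
    TorAcyclic R U (C ⊗[R] F) := by
  obtain ⟨I, hI, ⟨e⟩⟩ := hU
  refine TorAcyclic.congr_left (fun J _ _ _ ↦ ?_) e.symm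
  exact ((hC.torAcyclic_hom I).symm (F →ₗ[R] J)).congr_right
    (TensorProduct.lift.equiv (.id R) C F J)

end IsSemidualizing

end Semidualizing

/-! ### Foxby equivalence -/

section Foxby

variable {R : Type u} [CommRing R]

theorem RelGorenstein.of_mem {𝒰 ℱ : ObjectProperty (ModuleCat.{u} R)} {O N : ModuleCat.{u} R}
    [Subsingleton O] (hO : ℱ O) (hℱ : ∀ F U, ℱ F → 𝒰 U → TorAcyclic R U F) (hN : ℱ N) :
    RelGorenstein 𝒰 ℱ N :=
  ⟨ℱ, hN, fun A hA ↦ ⟨fun U hU ↦ hℱ A U hA hU, A, O, _, 0, .equiv_zero (.refl R A), hA, hO⟩⟩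

variable {C : Type u} [AddCommGroup C] [Module R C]

variable (R C) in
/-- The class consisting of the injective modules and `C`: the test modules for the class of
modules that corresponds to `𝒢ℱ_C ∩ ℬ_C` under Foxby equivalence. -/
def injectiveOrSelf : ObjectProperty (ModuleCat.{u} R) :=
  fun U ↦ injectiveModules R U ∨ U = .of R C

theorem cInjective_hom (I : Type u) [AddCommGroup I] [Module R I] [Module.Injective R I] :
    CInjective R C (.of R (C →ₗ[R] I)) :=
  ⟨.of R I, ‹_›, ⟨.refl R _⟩⟩

namespace IsSemidualizing

variable (hC : IsSemidualizing R C)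

include hC

section Transfer

variable (I : Type u) [AddCommGroup I] [Module R I] [Module.Injective R I]

theorem lTensor_lTensor_injective_iff {X Y : Type u} [AddCommGroup X] [Module R X]
    [AddCommGroup Y] [Module R Y] (f : X →ₗ[R] Y) :
    Function.Injective ((f.lTensor C).lTensor (C →ₗ[R] I)) ↔
      Function.Injective (f.lTensor I) := by
  let e₀ : (C →ₗ[R] I) ⊗[R] C ≃ₗ[R] I :=
    TensorProduct.comm R _ C ≪≫ₗ .ofBijective _ (hC.evalMap_bijective_of_injective I)
  let e (X : Type u) [AddCommGroup X] [Module R X] : (C →ₗ[R] I) ⊗[R] (C ⊗[R] X) ≃ₗ[R] I ⊗[R] X :=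
    (TensorProduct.assoc R _ C X).symm ≪≫ₗ e₀.rTensor X
  have h : f.lTensor I ∘ₗ e X = e Y ∘ₗ (f.lTensor C).lTensor (C →ₗ[R] I) := by
    ext φ c x
    simp [e]
  rw [← (e X).injective_comp, ← (e Y).comp_injective]
  exact iff_of_eq (congrArg (fun k : _ →ₗ[R] _ ↦ Function.Injective k) h.symm)

variable {A : Type u} [AddCommGroup A] [Module R A]

theorem torAcyclic_of_hom_tensor (hA : TorAcyclic R C A)
    (hA' : TorAcyclic R (C →ₗ[R] I) (C ⊗[R] A)) : TorAcyclic R I A := by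
  refine TorAcyclic.of_resolving
    (fun A ↦ TorAcyclic R C A ∧ TorAcyclic R (C →ₗ[R] I) (C ⊗[R] A)) ?_
    (Z := .of R A) ⟨hA, hA'⟩
  rintro A ⟨hA, hA'⟩
  obtain ⟨K, P, f, g, hs, hP⟩ := exists_free_presentation (R := R) A
  have hs' := hs.lTensor (hs.lTensor_injective hA)
  exact ⟨P, K, f, g, hs, .of_flat _ _,
    (hC.lTensor_lTensor_injective_iff I f).1 (hs'.lTensor_injective hA'),
    hs.torAcyclic_left (.of_flat _ _) hA,
    hs'.torAcyclic_left (hC.torAcyclic_tensor P (cInjective_hom I)) hA'⟩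

theorem torAcyclic_hom_tensor (hA : TorAcyclic R C A) (hA' : TorAcyclic R I A) :
    TorAcyclic R (C →ₗ[R] I) (C ⊗[R] A) := by
  refine TorAcyclic.of_resolving (fun B ↦ ∃ A : ModuleCat.{u} R, TorAcyclic R C A ∧
    TorAcyclic R I A ∧ B = .of R (C ⊗[R] A)) ?_ ⟨.of R A, hA, hA', rfl⟩
  rintro _ ⟨A, hA, hA', rfl⟩
  obtain ⟨K, P, f, g, hs, hP⟩ := exists_free_presentation (R := R) A
  exact ⟨.of R (C ⊗[R] P), .of R (C ⊗[R] K), _, _, hs.lTensor (hs.lTensor_injective hA),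
    hC.torAcyclic_tensor P (cInjective_hom I),
    (hC.lTensor_lTensor_injective_iff I f).2 (hs.lTensor_injective hA'), K,
    hs.torAcyclic_left (.of_flat _ _) hA, hs.torAcyclic_left (.of_flat _ _) hA', rfl⟩

end Transfer

theorem torAcyclic_of_cFlat {U F : ModuleCat.{u} R} (hU : CInjective R C U) (hF : CFlat R C F) :
    TorAcyclic R U F := by
  obtain ⟨F, hF, ⟨e⟩⟩ := hF
  exact (hC.torAcyclic_tensor F hU).congr_right e.symm

theorem gcFlat_eq_relGorenstein : GCFlat R C = RelGorenstein (CInjective R C) (CFlat R C) := by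
  ext N
  refine ⟨?_, RelGorenstein.exists_exactSeq⟩
  rintro ⟨S, hS₀, hS₁, hN, hU⟩
  refine S.relGorenstein (fun i U h ↦ ?_) hS₁ hU hN
  rcases le_or_gt i 0 with hi | hi
  · have := hS₀ i hi
    exact .of_flat _ _
  · exact hC.torAcyclic_of_cFlat h (hS₁ i hi)

theorem cFlat_le_gcFlat : CFlat R C ≤ GCFlat R C := by
  have hO : CFlat R C (.of R (C ⊗[R] PUnit.{u + 1})) :=
    ⟨.of R PUnit, inferInstanceAs (Module.Flat R PUnit.{u + 1}), ⟨.refl R _⟩⟩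
  have : Subsingleton (ModuleCat.of R (C ⊗[R] PUnit.{u + 1})) :=
    inferInstanceAs (Subsingleton (C ⊗[R] PUnit.{u + 1}))
  rw [hC.gcFlat_eq_relGorenstein]
  exact fun F ↦ .of_mem hO fun _ _ hF hU ↦ hC.torAcyclic_of_cFlat hU hF

theorem torAcyclic_hom_of_bass {N : ModuleCat.{u} R} (hB : Bass R C N)
    (hN : ∀ U, CInjective R C U → TorAcyclic R U N) {U : ModuleCat.{u} R}
    (hU : injectiveOrSelf R C U) : TorAcyclic R U (C →ₗ[R] N) := by
  obtain ⟨-, hTor, hev⟩ := bass_iff.1 hB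
  rcases hU with hU | rfl
  · exact hC.torAcyclic_of_hom_tensor U hTor
      ((hN _ (cInjective_hom U)).congr_right (LinearEquiv.ofBijective _ hev).symm)
  · exact hTor

theorem relGorenstein_hom {N : ModuleCat.{u} R} (hN : GCFlat R C N) (hB : Bass R C N) :
    RelGorenstein (injectiveOrSelf R C) (flatModules R) (.of R (C →ₗ[R] N)) := by
  refine ⟨fun A ↦ ∃ N, GCFlat R C N ∧ Bass R C N ∧ A = .of R (C →ₗ[R] N), ⟨N, hN, hB, rfl⟩, ?_⟩
  rintro _ ⟨N, hN, hB, rfl⟩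
  rw [hC.gcFlat_eq_relGorenstein] at hN
  refine ⟨fun U ↦ hC.torAcyclic_hom_of_bass hB fun U ↦ hN.torAcyclic, ?_⟩
  obtain ⟨V, N₁, f, g, hs, ⟨F, hF, ⟨e⟩⟩, hN₁⟩ := hN.exists_isShortExact
  rw [← hC.gcFlat_eq_relGorenstein] at hN₁
  obtain ⟨e', -⟩ := hC.exists_equiv_hom_tensor F
  have hV : Bass R C V := Bass.congr (hC.bass_tensor F) e.symm
  exact ⟨.of R (C →ₗ[R] V), .of R (C →ₗ[R] N₁), _, _,
    hs.hom (hs.comp_right_surjective (bass_iff.1 hB).1),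
    .of_linearEquiv (e.congrRight ≪≫ₗ e'.symm), N₁, hN₁, hs.bass_right hB hV, rfl⟩

theorem gcFlat_tensor_of_relGorenstein {A : ModuleCat.{u} R}
    (hA : RelGorenstein (injectiveOrSelf R C) (flatModules R) A) :
    GCFlat R C (.of R (C ⊗[R] A)) := by
  rw [hC.gcFlat_eq_relGorenstein]
  refine ⟨fun B ↦ ∃ A, RelGorenstein (injectiveOrSelf R C) (flatModules R) A ∧
    B = .of R (C ⊗[R] A), ⟨A, hA, rfl⟩, ?_⟩
  rintro _ ⟨A, hA, rfl⟩
  constructor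
  · rintro U ⟨I, hI, ⟨e⟩⟩
    exact (hC.torAcyclic_hom_tensor I (hA.torAcyclic (.inr rfl))
      (hA.torAcyclic (.inl hI))).congr_left e.symm
  · obtain ⟨F, K, f, g, hs, hF, hK⟩ := hA.exists_isShortExact
    exact ⟨.of R (C ⊗[R] F), .of R (C ⊗[R] K), _, _,
      hs.lTensor (hs.lTensor_injective (hK.torAcyclic (.inr rfl))),
      ⟨F, hF, ⟨.refl R _⟩⟩, K, hK, rfl⟩

end IsSemidualizing

end Foxby

/-! ### Stability of the Gorenstein construction -/

section Retract

variable {R A B X Y Z : Type*} [CommRing R] [AddCommGroup A] [Module R A] [AddCommGroup B]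
  [Module R B] [AddCommGroup X] [Module R X] [AddCommGroup Y] [Module R Y] [AddCommGroup Z]
  [Module R Z]

theorem rTensor_lTensor_apply (s : A →ₗ[R] B) (f : X →ₗ[R] Y) (t : A ⊗[R] X) :
    s.rTensor Y (f.lTensor A t) = f.lTensor B (s.rTensor X t) := by
  rw [← LinearMap.comp_apply, ← LinearMap.comp_apply, LinearMap.rTensor_comp_lTensor,
    LinearMap.lTensor_comp_rTensor]

theorem exact_lTensor_of_retract {f : X →ₗ[R] Y} {g : Y →ₗ[R] Z} {s : A →ₗ[R] B} {r : B →ₗ[R] A}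
    (hrs : r ∘ₗ s = LinearMap.id) (h : Function.Exact (f.lTensor B) (g.lTensor B)) :
    Function.Exact (f.lTensor A) (g.lTensor A) := by
  intro y
  constructor
  · intro hy
    obtain ⟨x, hx⟩ := (h (s.rTensor Y y)).1 (by rw [← rTensor_lTensor_apply, hy, map_zero])
    exact ⟨r.rTensor X x, by rw [← rTensor_lTensor_apply, hx, ← LinearMap.rTensor_comp_apply,
      hrs, LinearMap.rTensor_id_apply]⟩
  · rintro ⟨x, rfl⟩
    have hs : Function.LeftInverse (r.rTensor Z) (s.rTensor Z) := fun z ↦ by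
      rw [← LinearMap.rTensor_comp_apply, hrs, LinearMap.rTensor_id_apply]
    refine hs.injective ?_
    rw [rTensor_lTensor_apply, rTensor_lTensor_apply, h.apply_apply_eq_zero, map_zero]

end Retract

theorem exists_retract_characterModule {R : Type u} [CommRing R] (I : Type u) [AddCommGroup I]
    [Module R I] [hI : Module.Injective R I] :
    ∃ (F : ModuleCat.{u} R) (s : I →ₗ[R] CharacterModule F) (r : CharacterModule F →ₗ[R] I),
      Module.Free R F ∧ r ∘ₗ s = LinearMap.id := by
  let ev : I →ₗ[R] CharacterModule (CharacterModule I) :=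
    { toFun x := ⟨⟨fun c ↦ c x, rfl⟩, fun _ _ ↦ rfl⟩
      map_add' x y := CharacterModule.ext _ fun c ↦ map_add c x y
      map_smul' a x := CharacterModule.ext _ fun c ↦ rfl }
  have hev : Function.Injective ev := (injective_iff_map_eq_zero ev).2 fun x hx ↦
    CharacterModule.eq_zero_of_character_apply fun c ↦ DFunLike.congr_fun hx c
  let p := Finsupp.linearCombination R (id : CharacterModule I → CharacterModule I)
  have hp : Function.Injective (CharacterModule.dual p) :=
    CharacterModule.dual_injective_of_surjective _
      (Finsupp.linearCombination_id_surjective R (CharacterModule I))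
  obtain ⟨r, hr⟩ := hI.out (CharacterModule.dual p ∘ₗ ev) (hp.comp hev) LinearMap.id
  exact ⟨.of R (CharacterModule I →₀ R), CharacterModule.dual p ∘ₗ ev, r,
    inferInstanceAs (Module.Free R (CharacterModule I →₀ R)), LinearMap.ext hr⟩

section Stability

variable {R : Type u} [CommRing R]

namespace ExactSeq

variable {S : ExactSeq R}

theorem HomExact.congr {A B : Type u} [AddCommGroup A] [Module R A] [AddCommGroup B] [Module R B]
    (h : S.HomExact A) (e : A ≃ₗ[R] B) : S.HomExact B := by
  intro i k
  constructor
  · intro hk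
    obtain ⟨l, hl⟩ := (h i (k ∘ₗ e)).1 (LinearMap.ext fun a ↦ LinearMap.congr_fun hk (e a))
    exact ⟨l ∘ₗ e.symm, LinearMap.ext fun b ↦ by simpa using LinearMap.congr_fun hl (e.symm b)⟩
  · rintro ⟨l, rfl⟩
    exact LinearMap.ext fun b ↦ (S.exact i).apply_apply_eq_zero (l b)

variable {C : Type u} [AddCommGroup C] [Module R C]

theorem tensorExact_of_cInjective
    (h : ∀ (F : Type u) [AddCommGroup F] [Module R F] [Module.Free R F],
      S.TensorExact (CharacterModule (C ⊗[R] F)))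
    {U : ModuleCat.{u} R} (hU : CInjective R C U) : S.TensorExact U := by
  obtain ⟨I, hI, ⟨e⟩⟩ := hU
  obtain ⟨F, s, r, hF, hrs⟩ := exists_retract_characterModule (R := R) I
  let c : (C →ₗ[R] CharacterModule F) ≃ₗ[R] CharacterModule (C ⊗[R] F) :=
    CharacterModule.homEquiv
  have hrs' (k : C →ₗ[R] I) : r ∘ₗ s ∘ₗ k = k := by
    rw [← LinearMap.comp_assoc, hrs, LinearMap.id_comp]
  let s' : U →ₗ[R] CharacterModule (C ⊗[R] F) := c.toLinearMap ∘ₗ s.compRight R ∘ₗ e.toLinearMap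
  let r' : CharacterModule (C ⊗[R] F) →ₗ[R] U :=
    e.symm.toLinearMap ∘ₗ r.compRight R ∘ₗ c.symm.toLinearMap
  have hr's' : r' ∘ₗ s' = LinearMap.id := by
    ext u
    simp [r', s', hrs']
  exact fun i ↦ exact_lTensor_of_retract hr's' (h F i)

theorem HomExact.extAcyclic_range (h : S.HomExact C) (hX : ∀ i, ExtAcyclic R C (S.X i)) (i : ℤ) :
    ExtAcyclic R C (LinearMap.range (S.d i)) := by
  refine ExtAcyclic.of_coresolving (fun Z ↦ ∃ i, Z = .of R (LinearMap.range (S.d i))) ?_ ⟨i, rfl⟩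
  rintro _ ⟨i, rfl⟩
  exact ⟨S.X (i + 1), .of R (LinearMap.range (S.d (i + 1))), _, _, S.isShortExact i, hX _,
    h.comp_rangeRestrict_surjective i, i + 1, rfl⟩

theorem HomExact.evalMap_range_bijective (h : S.HomExact C)
    (hX : ∀ i, Function.Bijective (evalMap R C (S.X i))) (i : ℤ) :
    Function.Bijective (evalMap R C (LinearMap.range (S.d i))) := by
  have hsurj (i : ℤ) : Function.Surjective (evalMap R C (LinearMap.range (S.d i))) := by
    refine .of_comp (g := ((S.d i).rangeRestrict.compRight R).lTensor C) ?_
    rw [← LinearMap.coe_comp, evalMap_comp_lTensor]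
    exact (S.d i).surjective_rangeRestrict.comp (hX i).surjective
  obtain ⟨i, rfl⟩ : ∃ j, i = j + 1 := ⟨i - 1, by ring⟩
  exact (S.isShortExact i).evalMap_bijective (h.comp_rangeRestrict_surjective i) (hsurj i) (hX _)

theorem HomExact.bass_range (h : S.HomExact C) (hX : ∀ i, Bass R C (S.X i)) (i : ℤ) :
    Bass R C (.of R (LinearMap.range (S.d i))) := by
  have hev := h.evalMap_range_bijective fun i ↦ (bass_iff.1 (hX i)).2.2
  refine bass_iff.2 ⟨h.extAcyclic_range (fun i ↦ (bass_iff.1 (hX i)).1) i, ?_, hev i⟩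
  refine TorAcyclic.of_resolving
    (fun Z ↦ ∃ i, Z = .of R (C →ₗ[R] LinearMap.range (S.d i))) ?_ ⟨i, rfl⟩
  rintro _ ⟨i, rfl⟩
  obtain ⟨i, rfl⟩ : ∃ j, i = j + 1 := ⟨i - 1, by ring⟩
  exact ⟨.of R (C →ₗ[R] S.X (i + 1)), .of R (C →ₗ[R] LinearMap.range (S.d i)), _, _,
    (S.isShortExact i).hom (h.comp_rangeRestrict_surjective i), (bass_iff.1 (hX _)).2.1,
    lTensor_compRight_injective (S.isShortExact i).injective (hev i).injective, i, rfl⟩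

theorem HomExact.relGorenstein_hom_range (h : S.HomExact C) (hR : IsGFClosed R)
    (hC : IsSemidualizing R C) (hX : ∀ i, (GCFlat R C ⊓ Bass R C) (S.X i))
    (hU : ∀ U, CInjective R C U → S.TensorExact U) (i : ℤ) :
    RelGorenstein (injectiveOrSelf R C) (flatModules R)
      (.of R (C →ₗ[R] LinearMap.range (S.d i))) := by
  have := hR.relGorenstein (𝒰 := injectiveOrSelf R C) fun _ ↦ .inl
  have hTor (i : ℤ) (U : ModuleCat.{u} R) (h : CInjective R C U) : TorAcyclic R U (S.X i) :=
    (hC.gcFlat_eq_relGorenstein.le _ (hX i).1).torAcyclic h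
  refine RelGorenstein.of_coresolving
    (fun Z ↦ ∃ i, Z = .of R (C →ₗ[R] LinearMap.range (S.d i))) ?_ ⟨i, rfl⟩
  rintro _ ⟨i, rfl⟩
  refine ⟨fun U ↦ hC.torAcyclic_hom_of_bass (h.bass_range (fun i ↦ (hX i).2) i) fun U hU' ↦
    (hU U hU').torAcyclic_range (fun j _ ↦ hTor j U hU') le_rfl, ?_⟩
  exact ⟨.of R (C →ₗ[R] S.X (i + 1)), .of R (C →ₗ[R] LinearMap.range (S.d (i + 1))), _, _,
    (S.isShortExact i).hom (h.comp_rangeRestrict_surjective i),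
    hC.relGorenstein_hom (hX _).1 (hX _).2, i + 1, rfl⟩

end ExactSeq

variable {C : Type u} [AddCommGroup C] [Module R C] (hR : IsGFClosed R)
  (hC : IsSemidualizing R C)

include hC

theorem IsSemidualizing.gcFlat_congr {M N : ModuleCat.{u} R} (hM : GCFlat R C M)
    (e : M ≃ₗ[R] N) : GCFlat R C N := by
  rw [hC.gcFlat_eq_relGorenstein] at *
  exact hM.congr e

theorem IsSemidualizing.gcFlat_inf_bass_tensor (F : Type u) [AddCommGroup F] [Module R F]
    [Module.Flat R F] : (GCFlat R C ⊓ Bass R C) (.of R (C ⊗[R] F)) :=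
  ⟨hC.cFlat_le_gcFlat _ ⟨.of R F, ‹_›, ⟨.refl R _⟩⟩, hC.bass_tensor F⟩

include hR

theorem gorStep_gcFlat_inf_bass_le : gorStep (GCFlat R C ⊓ Bass R C) ≤ GCFlat R C ⊓ Bass R C := by
  rintro M ⟨S, hX, ⟨e⟩, hHom, hTensor⟩
  have hS : S.HomExact C :=
    (hHom _ (hC.gcFlat_inf_bass_tensor R)).congr (TensorProduct.rid R C)
  have hU (U) (hU : CInjective R C U) : S.TensorExact U :=
    ExactSeq.tensorExact_of_cInjective
      (fun F ↦ hTensor _ (hC.gcFlat_inf_bass_tensor F)) hU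
  have hB := hS.bass_range (fun i ↦ (hX i).2) 0
  have hG := hC.gcFlat_tensor_of_relGorenstein (hS.relGorenstein_hom_range hR hC hX hU 0)
  have e' : C ⊗[R] (C →ₗ[R] LinearMap.range (S.d 0)) ≃ₗ[R] LinearMap.range (S.d 0) :=
    .ofBijective _ (bass_iff.1 hB).2.2
  exact ⟨hC.gcFlat_congr hG (e' ≪≫ₗ e.symm), Bass.congr hB e.symm⟩

theorem gorStep_gcFlat_inf_bass :
    gorStep (GCFlat R C ⊓ Bass R C) = GCFlat R C ⊓ Bass R C := by
  have : Subsingleton (ModuleCat.of R (C ⊗[R] PUnit.{u + 1})) :=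
    inferInstanceAs (Subsingleton (C ⊗[R] PUnit.{u + 1}))
  exact le_antisymm (gorStep_gcFlat_inf_bass_le hR hC)
    (le_gorStep (hC.gcFlat_inf_bass_tensor PUnit))

end Stability

end GorFlat

theorem corollary4p6 (R : Type u) [CommRing R] (hR : GorFlat.IsGFClosed R)
    (C : Type u) [AddCommGroup C] [Module R C] (hC : GorFlat.IsSemidualizing R C)
    (n : ℕ) (hn : 1 ≤ n) :
    GorFlat.gorIter (GorFlat.GCFlat R C ⊓ GorFlat.Bass R C) n =
      GorFlat.GCFlat R C ⊓ GorFlat.Bass R C := by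
  induction n, hn using Nat.le_induction with
  | base => rfl
  | succ n hn ih =>
    obtain ⟨n, rfl⟩ := Nat.exists_eq_add_of_le' hn
    rw [GorFlat.gorIter, ih, GorFlat.gorStep_gcFlat_inf_bass hR hC]
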